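/- A dynamical system $(X,s)$ is a compact Hausdorff space $X$ with a homeomorphism $s\colon X\to X$. It is minimal if $X\neq\emptyset$ and $X$ has no proper non-empty closed set $Y$ with $s(Y)=Y$. Its subsystems are the pairs $(Y,s|_Y)$ with $Y\subseteq X$ non-empty, closed and $s(Y)=Y$. A system $(Y,t)$ is a factor of $(X,s)$ if there is a continuous surjection $\pi\colon X\to Y$ with $\pi\circ s=t\circ\pi$. The enveloping semigroup $E(X,s)$ is the closure of $\{s^n : n\in\mathbb Z\}$ in the product space $X^X$; with $\lambda_s(a)=s\circ a$, the pair $(E(X,s),\lambda_s)$ is again a system. $(X,s)$ is distal if all members of $E(X,s)$ are injective. Let $\mathbb T$ be the unit circle in $\mathbb C$. Let $G_0(X,s)$ be the group of constant functions $X\to\mathbb T$, let $G_{m+1}(X,s)$ be the group of continuous $g\colon X\to\mathbb T$ with $g\circ s=f\,g$ for some $f\in G_m(X,s)$, and let $G(X,s)=\bigcup_{m\ge 0} G_m(X,s)$. $(X,s)$ has quasi-discrete spectrum if the linear span of $G(X,s)$ is dense in $C(X)$, the continuous complex-valued functions on $X$ with the supremum norm. $(X,s)$ is a $\mathcal W$-system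 if $(E(X,s),\lambda_s)$ has quasi-discrete spectrum. Let $\mathcal W$ be the closed linear span in $\ell^\infty(\mathbb Z)$ of all functions $n\mapsto e^{2\pi i p(n)}$ with $p$ a real polynomial. For $x\in X$ let $\omega_x\colon C(X)\to\ell^\infty(\mathbb Z)$, $\omega_x(f)(n)=f(s^n x)$. Let $H(\mathbb T)$ be the set of all (not necessarily continuous) group homomorphisms $\mathbb T\to\mathbb T$, a group under the pointwise product, with the topology of pointwise convergence. Let $\mathcal H$ be the set of all sequences $(\phi_k)_{k\ge 0}$ in $H(\mathbb T)$ with $\phi_0=\mathrm{id}_{\mathbb T}$ and $$\phi_k(x^{k!})=\prod_{j=1}^k \phi_1^{(j)}\bigl(x^{s(k,j)}\bigr)\quad\text{for all } k\ge 1 \text{ and all } x=e^{2\pi i q},\ q\in\mathbb Q,$$ where $\phi_1^{(j)}$ is the $j$-fold composition of $\phi_1$ and the integers $s(k,j)$ are the Stirling numbers of the first kind, $n(n-1)\cdots(n-k+1)=\sum_{j=0}^k s(k,j)n^j$. Give $\mathcal H$ the subspace topology of the product $H(\mathbb T)^{\{0,1,2,\dots\}}$, and let $T(\phi_0,\phi_1,\phi_2,\dots)=(\phi_0,\phi_0\phi_1,\phi_1\phi_2,\dots)$,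 a homeomorphism of $\mathcal H$. **Proposition.** Let $(X,s)$ be a minimal system. The following conditions are equivalent: (i) $(X,s)$ is a $\mathcal W$-system; (ii) $(X,s)$ is a factor of $(\mathcal H,T)$; (iii) there is a point $x\in X$ with $\omega_x C(X)\subseteq\mathcal W$; (iv) $\omega_x C(X)\subseteq\mathcal W$ for every $x\in X$. If $(X,s)$ is a dynamical system, not necessarily minimal, then (i), (iv) and the following condition are equivalent: (v) $(X,s)$ is distal, and all its minimal subsystems are $\mathcal W$-systems. -/

import Mathlib

open Topology Polynomial

noncomputable section

namespace EllisW

universe u v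

/-! ### Dynamical systems

A dynamical system is a compact Hausdorff space `X` together with a homeomorphism `s : X ≃ₜ X`.
-/

/-- A set `Y` is invariant under `s` if `s(Y) = Y`. -/
def IsInvariant {X : Type u} [TopologicalSpace X] (s : X ≃ₜ X) (Y : Set X) : Prop :=
  s '' Y = Y

theorem IsInvariant.mem_iff {X : Type u} [TopologicalSpace X] {s : X ≃ₜ X} {Y : Set X}
    (h : IsInvariant s Y) (x : X) : x ∈ Y ↔ s x ∈ Y := by
  constructor
  · intro hx
    have : s x ∈ s '' Y := ⟨x, hx, rfl⟩
    rwa [h] at this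
  · intro hx
    rw [← h] at hx
    obtain ⟨y, hy, hyx⟩ := hx
    rwa [← s.injective hyx]

/-- The restriction of `s` to an invariant set `Y`. -/
def restrict {X : Type u} [TopologicalSpace X] (s : X ≃ₜ X) {Y : Set X}
    (h : IsInvariant s Y) : Y ≃ₜ Y :=
  s.subtype h.mem_iff

/-- `(X, s)` is minimal: the phase space is non-empty and has no proper non-empty closed
invariant subset. -/
def IsMinimalSystem {X : Type u} [TopologicalSpace X] (s : X ≃ₜ X) : Prop :=
  Nonempty X ∧ ∀ Y : Set X, IsClosed Y → IsInvariant s Y → Y.Nonempty → Y = Set.univ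

/-- `(Y, t)` is a factor of `(X, s)`: there is a continuous surjection `π : X → Y` with
`π ∘ s = t ∘ π`. -/
def IsFactor {X : Type u} {Y : Type v} [TopologicalSpace X] [TopologicalSpace Y]
    (s : X ≃ₜ X) (t : Y ≃ₜ Y) : Prop :=
  ∃ π : X → Y, Continuous π ∧ Function.Surjective π ∧ ∀ x, π (s x) = t (π x)

/-! ### The enveloping semigroup -/

/-- The enveloping semigroup `E(X, s)`: the closure of `{s ^ n : n ∈ ℤ}` in the product
space `X ^ X`. -/
def envelopingSemigroup {X : Type u} [TopologicalSpace X] (s : X ≃ₜ X) : Set (X → X) :=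
  closure (Set.range fun n : ℤ => ((s ^ n : X ≃ₜ X) : X → X))

/-- The homeomorphism `a ↦ s ∘ a` of the product space `X ^ X`. -/
def leftMul {X : Type u} [TopologicalSpace X] (s : X ≃ₜ X) : (X → X) ≃ₜ (X → X) :=
  Homeomorph.piCongrRight fun _ => s

theorem leftMul_apply {X : Type u} [TopologicalSpace X] (s : X ≃ₜ X) (a : X → X) :
    leftMul s a = s ∘ a := rfl

theorem envelopingSemigroup_invariant {X : Type u} [TopologicalSpace X] (s : X ≃ₜ X) :
    IsInvariant (leftMul s) (envelopingSemigroup s) := by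
  unfold IsInvariant envelopingSemigroup
  rw [Homeomorph.image_closure]
  congr 1
  ext a
  constructor
  · rintro ⟨_, ⟨n, rfl⟩, rfl⟩
    refine ⟨1 + n, ?_⟩
    funext x
    simp only [zpow_add, zpow_one, leftMul_apply]
    rfl
  · rintro ⟨n, rfl⟩
    refine ⟨_, ⟨n - 1, rfl⟩, ?_⟩
    have h : s ^ n = s * s ^ (n - 1) := by rw [← zpow_one_add]; congr 1; ring
    funext x
    simp only [h, leftMul_apply]
    rfl

/-- The system `(E(X, s), λ_s)`, where `λ_s(a) = s ∘ a`. -/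
def ellisSystem {X : Type u} [TopologicalSpace X] (s : X ≃ₜ X) :
    envelopingSemigroup s ≃ₜ envelopingSemigroup s :=
  restrict (leftMul s) (envelopingSemigroup_invariant s)

/-- `(X, s)` is distal: all members of `E(X, s)` are injective. -/
def IsDistal {X : Type u} [TopologicalSpace X] (s : X ≃ₜ X) : Prop :=
  ∀ a ∈ envelopingSemigroup s, Function.Injective a

/-! ### Quasi-discrete spectrum -/

/-- For a subgroup `G` of `C(X, 𝕋)`, the subgroup `G ^ s` of all `g ∈ C(X, 𝕋)` with
`g ∘ s = f g` for some `f ∈ G`. -/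
def nextGroup {X : Type u} [TopologicalSpace X] (s : X ≃ₜ X) (G : Subgroup C(X, Circle)) :
    Subgroup C(X, Circle) where
  carrier := {g | ∃ f ∈ G, ∀ x, g (s x) = f x * g x}
  one_mem' := ⟨1, G.one_mem, fun x => by simp⟩
  mul_mem' := by
    rintro a b ⟨f, hf, hfa⟩ ⟨g, hg, hgb⟩
    refine ⟨f * g, G.mul_mem hf hg, fun x => ?_⟩
    simp only [ContinuousMap.mul_apply, hfa, hgb]
    exact mul_mul_mul_comm _ _ _ _
  inv_mem' := by
    rintro a ⟨f, hf, hfa⟩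
    refine ⟨f⁻¹, G.inv_mem hf, fun x => ?_⟩
    simp only [ContinuousMap.inv_apply, hfa, mul_inv]

/-- The group of constant functions `X → 𝕋`. -/
def constGroup (X : Type u) [TopologicalSpace X] : Subgroup C(X, Circle) where
  carrier := {g | ∃ c : Circle, ∀ x, g x = c}
  one_mem' := ⟨1, fun x => by simp⟩
  mul_mem' := by
    rintro a b ⟨c, hc⟩ ⟨d, hd⟩
    exact ⟨c * d, fun x => by simp [hc, hd]⟩
  inv_mem' := by
    rintro a ⟨c, hc⟩
    exact ⟨c⁻¹, fun x => by simp [hc]⟩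

/-- The groups `G_m(X, s)`: `G_0` consists of the constants, and `G_{m+1} = (G_m) ^ s`. -/
def quasiEigenGroup {X : Type u} [TopologicalSpace X] (s : X ≃ₜ X) :
    ℕ → Subgroup C(X, Circle)
  | 0 => constGroup X
  | m + 1 => nextGroup s (quasiEigenGroup s m)

/-- `g` is a quasi-eigenfunction of `(X, s)`: it belongs to the union of the `G_m(X, s)`. -/
def IsQuasiEigenfunction {X : Type u} [TopologicalSpace X] (s : X ≃ₜ X)
    (g : C(X, Circle)) : Prop :=
  ∃ m : ℕ, g ∈ quasiEigenGroup s m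

/-- `(X, s)` has (topological) quasi-discrete spectrum: the linear span of the
quasi-eigenfunctions is dense in `C(X)`. -/
def HasQuasiDiscreteSpectrum {X : Type u} [TopologicalSpace X] (s : X ≃ₜ X) : Prop :=
  Dense (Submodule.span ℂ
    {f : C(X, ℂ) | ∃ g : C(X, Circle), IsQuasiEigenfunction s g ∧ ∀ x, f x = (g x : ℂ)} :
    Set C(X, ℂ))

/-- `(X, s)` is a `𝓦`-system: `(E(X, s), λ_s)` has quasi-discrete spectrum. -/
def IsWSystem {X : Type u} [TopologicalSpace X] (s : X ≃ₜ X) : Prop :=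
  HasQuasiDiscreteSpectrum (ellisSystem s)

/-! ### The Weyl algebra

The space `l^∞(ℤ)` is realised as the space `BoundedContinuousFunction ℤ ℂ` of all bounded
functions on the discrete space `ℤ`, with the supremum norm. -/

/-- The functions of polynomial type: `n ↦ exp (2 π i p(n))`, `p` a real polynomial. -/
def polynomialType : Set (BoundedContinuousFunction ℤ ℂ) :=
  {f | ∃ p : ℝ[X], ∀ n : ℤ,
    f n = Complex.exp (2 * Real.pi * Complex.I * ((p.eval (n : ℝ) : ℝ) : ℂ))}

/-- The Weyl algebra `𝓦`: the closed linear span of the functions of polynomial type. -/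
def weylAlgebra : Submodule ℂ (BoundedContinuousFunction ℤ ℂ) :=
  (Submodule.span ℂ polynomialType).topologicalClosure

/-- The function `ω_x(f) ∈ l^∞(ℤ)`, `ω_x(f)(n) = f(s ^ n x)`. -/
def omega {X : Type u} [TopologicalSpace X] [CompactSpace X] (s : X ≃ₜ X) (x : X)
    (f : C(X, ℂ)) : BoundedContinuousFunction ℤ ℂ :=
  (BoundedContinuousFunction.mkOfCompact f).compContinuous
    ⟨fun n : ℤ => (s ^ n : X ≃ₜ X) x, continuous_of_discreteTopology⟩

/-! ### The system `(𝓗, T)` -/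

/-- `H(𝕋)`: all (not necessarily continuous) endomorphisms of the group `𝕋`, a group under the
pointwise product. -/
abbrev EndCircle : Type := Circle →* Circle

/-- `H(𝕋)` carries the topology of pointwise convergence. -/
instance instTopologicalSpaceEndCircle : TopologicalSpace EndCircle :=
  TopologicalSpace.induced (fun φ : EndCircle => (φ : Circle → Circle)) inferInstance

instance instIsTopologicalGroupEndCircle : IsTopologicalGroup EndCircle :=
  topologicalGroup_induced (MonoidHom.coeFn Circle Circle)

/-- The map `(g₀, g₁, g₂, …) ↦ (g₀, g₀ g₁, g₁ g₂, …)`. -/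
def shiftFun {G : Type u} [CommGroup G] (g : ℕ → G) : ℕ → G
  | 0 => g 0
  | k + 1 => g k * g (k + 1)

/-- The inverse of `shiftFun`. -/
def shiftInv {G : Type u} [CommGroup G] (g : ℕ → G) : ℕ → G
  | 0 => g 0
  | k + 1 => (shiftInv g k)⁻¹ * g (k + 1)

/-- The homeomorphism `A_G` of `G ^ ℕ`, `A_G(g₀, g₁, g₂, …) = (g₀, g₀ g₁, g₁ g₂, …)`. -/
def shiftHomeo (G : Type u) [CommGroup G] [TopologicalSpace G] [IsTopologicalGroup G] :
    (ℕ → G) ≃ₜ (ℕ → G) where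
  toFun := shiftFun
  invFun := shiftInv
  left_inv g := by
    funext k
    induction k with
    | zero => rfl
    | succ k ih => simp [shiftInv, ih, shiftFun]
  right_inv g := by
    funext k
    cases k with
    | zero => rfl
    | succ k => simp [shiftInv, shiftFun]
  continuous_toFun := by
    refine continuous_pi fun k => ?_
    cases k with
    | zero => exact continuous_apply 0
    | succ k => exact (continuous_apply k).mul (continuous_apply (k + 1))
  continuous_invFun := by
    refine continuous_pi fun k => ?_
    induction k with
    | zero => exact continuous_apply 0
    | succ k ih => exact ih.inv.mul (continuous_apply (k + 1))

/-- The group `𝕋_Q` of all `exp (2 π i q)` with `q` rational. -/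
def rationalCircle : Set Circle :=
  {x | ∃ q : ℚ, x = Circle.exp (2 * Real.pi * (q : ℝ))}

/-- The (signed) Stirling number of the first kind `s(k, j)`: the coefficient of `n ^ j` in
`n (n - 1) ⋯ (n - k + 1)`. -/
def stirling (k j : ℕ) : ℤ := (descPochhammer ℤ k).coeff j

/-- The space `𝓗`: all sequences `(φ_k)_{k ≥ 0}` in `H(𝕋)` with `φ_0 = id` and
`φ_k(x ^ k!) = ∏_{j=1}^k φ_1^{(j)}(x ^ s(k, j))` for all `x ∈ 𝕋_Q` and `k ≥ 1`, where
`φ_1^{(j)}` is the `j`-fold composition. -/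
def spaceH : Set (ℕ → EndCircle) :=
  {φ | φ 0 = MonoidHom.id Circle ∧ ∀ k : ℕ, 1 ≤ k → ∀ x ∈ rationalCircle,
    φ k (x ^ k.factorial) = ∏ j ∈ Finset.Icc 1 k, (φ 1)^[j] (x ^ stirling k j)}

/-! The next facts show that `𝓗` is invariant under `T = A_{H(𝕋)}`. -/

/-- An endomorphism of `𝕋` as an element of the endomorphism ring of `𝕋`, written additively. -/
def toEnd (φ : EndCircle) : AddMonoid.End (Additive Circle) := MonoidHom.toAdditive φ

theorem toEnd_apply (φ : EndCircle) (x : Additive Circle) :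
    toEnd φ x = Additive.ofMul (φ x.toMul) := rfl

theorem toEnd_mul_id (φ : EndCircle) : toEnd (MonoidHom.id Circle * φ) = toEnd φ + 1 := by
  refine AddMonoidHom.ext fun x => ?_
  exact congrArg Additive.ofMul (mul_comm x.toMul (φ x.toMul))

theorem toEnd_pow_apply (φ : EndCircle) (j : ℕ) (x : Circle) :
    (toEnd φ ^ j) (Additive.ofMul x) = Additive.ofMul (φ^[j] x) := by
  induction j generalizing x with
  | zero => rfl
  | succ j ih =>
    rw [pow_succ, Function.iterate_succ_apply, ← ih]
    rfl

theorem prod_iterate_eq (φ : EndCircle) (k : ℕ) (hk : 1 ≤ k) (x : Circle) :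
    Additive.ofMul (∏ j ∈ Finset.Icc 1 k, φ^[j] (x ^ stirling k j)) =
      (aeval (toEnd φ) (descPochhammer ℤ k)) (Additive.ofMul x) := by
  have h0 : (descPochhammer ℤ k).coeff 0 = 0 := by
    rw [coeff_zero_eq_eval_zero, descPochhammer_eval_zero]
    simp [Nat.one_le_iff_ne_zero.mp hk]
  have hsum : ∀ (S : Finset ℕ) (F : ℕ → AddMonoid.End (Additive Circle)) (y : Additive Circle),
      (∑ j ∈ S, F j) y = ∑ j ∈ S, F j y := fun S F y => AddMonoidHom.finsetSum_apply F S y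
  rw [aeval_eq_sum_range, descPochhammer_natDegree, ofMul_prod, Finset.range_eq_Ico,
    Finset.sum_eq_sum_Ico_succ_bot (Nat.succ_pos k), h0,
    zero_smul ℤ (toEnd φ ^ 0), zero_add, zero_add, hsum]
  refine Finset.sum_congr rfl fun j _ => ?_
  rw [← toEnd_pow_apply, ofMul_zpow, map_zsmul]
  rfl

theorem descPochhammer_comp_add_one (k : ℕ) :
    (descPochhammer ℤ (k + 1)).comp (X + 1) =
      descPochhammer ℤ (k + 1) + (k + 1 : ℤ[X]) * descPochhammer ℤ k := by
  have h1 : (descPochhammer ℤ (k + 1)).comp (X + 1) = (X + 1) * descPochhammer ℤ k := by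
    rw [descPochhammer_succ_left, mul_comp, X_comp, comp_assoc]
    simp
  rw [h1, descPochhammer_succ_right]
  ring

theorem aeval_add_one (a : AddMonoid.End (Additive Circle)) (k : ℕ) :
    aeval (a + 1) (descPochhammer ℤ (k + 1)) =
      aeval a (descPochhammer ℤ (k + 1)) + aeval a (descPochhammer ℤ k) * ((k + 1 : ℕ)) := by
  have h := congrArg (aeval a) (descPochhammer_comp_add_one k)
  rw [aeval_comp] at h
  simp only [map_add, aeval_X, map_one, map_mul, map_natCast] at h
  rw [h, ← Nat.cast_succ, (Nat.cast_commute (k + 1) _).eq]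

theorem pow_mem_rationalCircle {x : Circle} (hx : x ∈ rationalCircle) (n : ℕ) :
    x ^ n ∈ rationalCircle := by
  obtain ⟨q, rfl⟩ := hx
  refine ⟨n * q, ?_⟩
  induction n with
  | zero => simp
  | succ n ih =>
    rw [pow_succ, ih, ← Circle.exp_add]
    congr 1
    push_cast
    ring

/-- The defining condition of `𝓗` for one index `k`, in the endomorphism ring. -/
def condH (φ : ℕ → EndCircle) (k : ℕ) : Prop :=
  ∀ x ∈ rationalCircle, Additive.ofMul (φ k (x ^ k.factorial)) =
    (aeval (toEnd (φ 1)) (descPochhammer ℤ k)) (Additive.ofMul x)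

theorem mem_spaceH_iff (φ : ℕ → EndCircle) :
    φ ∈ spaceH ↔ φ 0 = MonoidHom.id Circle ∧ ∀ k, condH φ k := by
  constructor
  · rintro ⟨h0, h⟩
    refine ⟨h0, fun k x hx => ?_⟩
    rcases Nat.eq_zero_or_pos k with rfl | hk
    · simp [h0]
    · rw [h k hk x hx, prod_iterate_eq _ _ hk]
  · rintro ⟨h0, h⟩
    refine ⟨h0, fun k hk x hx => ?_⟩
    apply Additive.ofMul.injective
    rw [h k x hx, prod_iterate_eq _ _ hk]

theorem condH_shift_iff (φ : ℕ → EndCircle) (h0 : φ 0 = MonoidHom.id Circle) (k : ℕ)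
    (hk : condH φ k) : condH (shiftFun φ) (k + 1) ↔ condH φ (k + 1) := by
  refine forall₂_congr fun x hx => ?_
  have h1 : shiftFun φ 1 = MonoidHom.id Circle * φ 1 := by
    change φ 0 * φ 1 = _
    rw [h0]
  have h2 : shiftFun φ (k + 1) (x ^ (k + 1).factorial) =
      φ k ((x ^ (k + 1)) ^ k.factorial) * φ (k + 1) (x ^ (k + 1).factorial) := by
    rw [← pow_mul, ← Nat.factorial_succ]
    rfl
  have h3 : (aeval (toEnd (φ 1)) (descPochhammer ℤ k) * ((k + 1 : ℕ)))
      (Additive.ofMul x) =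
      (aeval (toEnd (φ 1)) (descPochhammer ℤ k)) (Additive.ofMul (x ^ (k + 1))) := by
    rw [AddMonoid.End.coe_mul, Function.comp_apply, AddMonoid.End.natCast_apply, ofMul_pow]
  have h4 : ∀ (a b : AddMonoid.End (Additive Circle)) (y : Additive Circle),
      (a + b) y = a y + b y := fun _ _ _ => rfl
  rw [h1, toEnd_mul_id, aeval_add_one, h2, ofMul_mul, hk _ (pow_mem_rationalCircle hx _),
    h4, h3, add_comm]
  exact add_left_inj _

theorem shift_mem_spaceH_iff (φ : ℕ → EndCircle) : shiftFun φ ∈ spaceH ↔ φ ∈ spaceH := by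
  rw [mem_spaceH_iff, mem_spaceH_iff]
  have hz : ∀ ψ : ℕ → EndCircle, ψ 0 = MonoidHom.id Circle → condH ψ 0 := by
    intro ψ h x _
    simp [h]
  refine and_congr_right fun h0 => ?_
  change φ 0 = MonoidHom.id Circle at h0
  constructor
  · intro h k
    induction k with
    | zero => exact hz φ h0
    | succ k ih => exact (condH_shift_iff φ h0 k ih).1 (h (k + 1))
  · intro h k
    cases k with
    | zero => exact hz _ h0
    | succ k => exact (condH_shift_iff φ h0 k (h k)).2 (h (k + 1))

theorem spaceH_invariant : IsInvariant (shiftHomeo EndCircle) spaceH := by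
  ext φ
  constructor
  · rintro ⟨ψ, hψ, rfl⟩
    exact (shift_mem_spaceH_iff ψ).2 hψ
  · intro h
    refine ⟨(shiftHomeo EndCircle).symm φ, ?_, (shiftHomeo EndCircle).apply_symm_apply φ⟩
    apply (shift_mem_spaceH_iff _).1
    change shiftHomeo EndCircle ((shiftHomeo EndCircle).symm φ) ∈ spaceH
    rwa [Homeomorph.apply_symm_apply]

/-- The system `(𝓗, T)`, where `T(φ₀, φ₁, φ₂, …) = (φ₀, φ₀ φ₁, φ₁ φ₂, …)`. -/
def systemH : spaceH ≃ₜ spaceH :=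
  restrict (shiftHomeo EndCircle) spaceH_invariant

end EllisW

end

open Topology Polynomial

noncomputable section

namespace EllisW

universe u v

open scoped PowerSeries.WithPiTopology

/-! ### Groups of circle-valued functions -/

/-! Let `R` be the ring of all endomorphisms of the circle, compact for pointwise convergence; only
the right multiplications of `R` are continuous. Encode a sequence `(φ_k)` as the power series `∑
φ_k X ^ k` over `R`. Then `T` is multiplication by the central unit `1 + X`. Let `K`
(`orbitClosure`) be the closure of the powers of `1 + X`. It is a compact group whose right
multiplications are continuous.

The coordinates `a ↦ a_k(t)` are quasi-eigenfunctions on `K`, and along the dense orbit of `1` the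
group they generate yields every function of polynomial type. So every member of `𝓦` extends
continuously to `K`, and `ω_x C(X) ⊆ 𝓦` means that `n ↦ s ^ n x` extends to a continuous equivariant
map `K → X` (`exists_orbit_map`). If this holds for all `x`, these maps combine to a continuous
homomorphism of `K` onto `E(X, s)`, with a closed normal kernel `N`.

The main point is that such a quotient `K / N` again has quasi-discrete spectrum, and this rests on
the shape of `N` (`eq_one_or_exists_level`). Consider the closed groups of leading coefficients, at
each power of `X`, of members of `N`. Commutators with `K`, whose first coefficients exhaust `R`,
carry a leading coefficient `φ` to `φψ - ψφ` one degree higher, for every `ψ` in `R`. Since `R` is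
far from commutative (`exists_not_commute`) and closed subgroups of `R` are determined by their
annihilators (`mem_of_forall_annihilator`), one nonzero leading group forces all later ones to
contain every endomorphism that kills torsion. On torsion, the first coefficient determines all
others, so successive approximation and compactness show that `N` is trivial or cut out of `K` by
conditions on the coefficients up to a single degree `r + 1`. The coordinates that descend to `K /
N` then separate its points, and Stone–Weierstrass applies.

The same approximation with `N = K` shows `K = 𝓗`, which makes `𝓗` universal for the minimal systems
in question. In the distal case every orbit closure is minimal, so membership in `𝓦` can be tested
on minimal subsystems. -/

theorem dense_span_of_separatesPoints {Y : Type u} [TopologicalSpace Y] [CompactSpace Y]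
    (G : Subgroup C(Y, Circle)) (hG : ∀ x y : Y, x ≠ y → ∃ g ∈ G, g x ≠ g y) :
    Dense (Submodule.span ℂ {f : C(Y, ℂ) | ∃ g : C(Y, Circle), g ∈ G ∧ ∀ x, f x = (g x : ℂ)} :
      Set C(Y, ℂ)) := by
  set S : Set C(Y, ℂ) := {f | ∃ g : C(Y, Circle), g ∈ G ∧ ∀ x, f x = (g x : ℂ)} with hS
  have hstar : star S ⊆ S := by
    rintro f ⟨g, hg, hf⟩
    refine ⟨g⁻¹, G.inv_mem hg, fun x => ?_⟩
    have h1 : star (f x) = (g x : ℂ) := hf x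
    rw [ContinuousMap.inv_apply, Circle.coe_inv_eq_conj, ← h1]
    exact (star_star (f x)).symm
  -- The functions from `G` are closed under products and conjugation, so their linear span is
  -- already the star algebra they generate.
  have hclosure : (Submonoid.closure (S ∪ star S) : Set C(Y, ℂ)) = S := by
    rw [Set.union_eq_self_of_subset_right hstar]
    let M : Submonoid C(Y, ℂ) :=
      { carrier := S
        one_mem' := ⟨1, G.one_mem, fun x => by simp⟩
        mul_mem' := by
          rintro a b ⟨g, hg, ha⟩ ⟨g', hg', hb⟩
          exact ⟨g * g', G.mul_mem hg hg', fun x => by simp [ha, hb]⟩ }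
    exact congrArg SetLike.coe (Submonoid.closure_eq M)
  have hsep : (StarAlgebra.adjoin ℂ S).SeparatesPoints := by
    intro x y hxy
    obtain ⟨g, hg, hne⟩ := hG x y hxy
    let f : C(Y, ℂ) := ⟨fun x => (g x : ℂ), by fun_prop⟩
    refine ⟨f, ⟨f, StarAlgebra.subset_adjoin ℂ S ⟨g, hg, fun x => rfl⟩, rfl⟩, fun h => hne ?_⟩
    exact Circle.ext h
  have hdense := ContinuousMap.starSubalgebra_topologicalClosure_eq_top_of_separatesPoints _ hsep
  have hspan : (Submodule.span ℂ S : Set C(Y, ℂ)) = (StarAlgebra.adjoin ℂ S : Set C(Y, ℂ)) := by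
    have := StarAlgebra.adjoin_eq_span (R := ℂ) S
    rw [hclosure] at this
    rw [← this]
    rfl
  rw [hspan, dense_iff_closure_eq, ← StarSubalgebra.topologicalClosure_coe, hdense]
  rfl

/-! ### The compact ring of endomorphisms of the circle -/

/-- The endomorphism ring of the circle, written additively. -/
abbrev CircleEnd : Type := AddMonoid.End (Additive Circle)

instance instTopologicalSpaceCircleEnd : TopologicalSpace CircleEnd :=
  TopologicalSpace.induced (fun φ : CircleEnd => (φ : Additive Circle → Additive Circle))
    inferInstance

instance : CompactSpace (Additive Circle) := inferInstanceAs (CompactSpace Circle)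

instance : T2Space (Additive Circle) := inferInstanceAs (T2Space Circle)

theorem CircleEnd.isEmbedding_coe :
    IsEmbedding (fun φ : CircleEnd => (φ : Additive Circle → Additive Circle)) :=
  ⟨⟨rfl⟩, DFunLike.coe_injective⟩

theorem CircleEnd.continuous_iff {Y : Type u} [TopologicalSpace Y] {f : Y → CircleEnd} :
    Continuous f ↔ ∀ t : Additive Circle, Continuous fun y => f y t := by
  rw [CircleEnd.isEmbedding_coe.continuous_iff, continuous_pi_iff]
  rfl

theorem CircleEnd.continuous_eval (t : Additive Circle) :
    Continuous fun φ : CircleEnd => φ t :=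
  CircleEnd.continuous_iff.1 continuous_id t

theorem CircleEnd.isClosedEmbedding_coe :
    IsClosedEmbedding (fun φ : CircleEnd => (φ : Additive Circle → Additive Circle)) := by
  refine ⟨CircleEnd.isEmbedding_coe, ?_⟩
  have : Set.range (fun φ : CircleEnd => (φ : Additive Circle → Additive Circle)) =
      ⋂ (a : Additive Circle) (b : Additive Circle),
        {f : Additive Circle → Additive Circle | f (a + b) = f a + f b} := by
    ext f
    simp only [Set.mem_range, Set.mem_iInter, Set.mem_ofPred_eq]
    constructor
    · rintro ⟨φ, rfl⟩ a b
      exact map_add φ a b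
    · intro h
      exact ⟨(AddMonoidHom.mk' f h : CircleEnd), rfl⟩
  rw [this]
  exact isClosed_iInter fun a => isClosed_iInter fun b =>
    isClosed_eq (by fun_prop) (by fun_prop)

instance : CompactSpace CircleEnd := CircleEnd.isClosedEmbedding_coe.compactSpace

instance : T2Space CircleEnd := CircleEnd.isEmbedding_coe.t2Space

theorem CircleEnd.add_apply (φ ψ : CircleEnd) (t : Additive Circle) :
    (φ + ψ) t = φ t + ψ t := rfl

theorem CircleEnd.mul_apply (φ ψ : CircleEnd) (t : Additive Circle) :
    (φ * ψ) t = φ (ψ t) := rfl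

theorem CircleEnd.sub_apply (φ ψ : CircleEnd) (t : Additive Circle) :
    (φ - ψ) t = φ t - ψ t := rfl

instance : IsTopologicalAddGroup CircleEnd where
  continuous_add := CircleEnd.continuous_iff.2 fun t =>
    ((CircleEnd.continuous_eval t).comp continuous_fst).add
      ((CircleEnd.continuous_eval t).comp continuous_snd)
  continuous_neg := CircleEnd.continuous_iff.2 fun t => (CircleEnd.continuous_eval t).neg

/-- Evaluating `φ * ψ` at `t` is evaluating `φ` at the fixed point `ψ t`. Left multiplication by a
discontinuous `φ` has no such reason to be continuous, so all later limits are taken in the left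
factor. -/
theorem CircleEnd.continuous_mul_right (ψ : CircleEnd) :
    Continuous fun φ : CircleEnd => φ * ψ :=
  CircleEnd.continuous_iff.2 fun t => CircleEnd.continuous_eval (ψ t)

/-- The character `φ ↦ φ t` of the group of endomorphisms of the circle. -/
def evalCircle (t : Additive Circle) : C(CircleEnd, Circle) :=
  ⟨fun φ => (φ t).toMul, CircleEnd.continuous_eval t⟩

/-- The group of all characters `φ ↦ φ t`. -/
def evalGroup : Subgroup C(CircleEnd, Circle) where
  carrier := Set.range evalCircle
  one_mem' := ⟨0, ContinuousMap.ext fun φ => congrArg Additive.toMul (map_zero φ)⟩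
  mul_mem' := by
    rintro _ _ ⟨a, rfl⟩ ⟨b, rfl⟩
    exact ⟨a + b, ContinuousMap.ext fun φ => congrArg Additive.toMul (map_add φ a b)⟩
  inv_mem' := by
    rintro _ ⟨a, rfl⟩
    exact ⟨-a, ContinuousMap.ext fun φ => congrArg Additive.toMul (map_neg φ a)⟩

/-! ### Duality for closed groups of endomorphisms -/

section Annihilator

open MeasureTheory

instance : MeasurableSpace CircleEnd := borel _

instance : BorelSpace CircleEnd := ⟨rfl⟩

theorem integral_circle_eq_zero {C : Type*} [AddGroup C] [TopologicalSpace C]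
    [IsTopologicalAddGroup C] [MeasurableSpace C] [BorelSpace C] (μ : Measure C)
    [μ.IsAddLeftInvariant] (χ : C → Circle) (hχ : ∀ a b, χ (a + b) = χ a * χ b)
    (c : C) (hc : χ c ≠ 1) : ∫ x, (χ x : ℂ) ∂μ = 0 := by
  have h1 : ∫ x, (χ (c + x) : ℂ) ∂μ = ∫ x, (χ x : ℂ) ∂μ :=
    integral_add_left_eq_self (fun x => (χ x : ℂ)) c
  simp only [hχ, Circle.coe_mul, integral_const_mul] at h1
  by_contra h0
  apply hc
  apply Circle.ext
  simpa using mul_right_cancel₀ h0 (h1.trans (one_mul _).symm)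

/-- A closed group of endomorphisms of the circle is determined by its annihilator. -/
theorem mem_of_forall_annihilator (C : AddSubgroup CircleEnd) (hC : IsClosed (C : Set CircleEnd))
    (φ : CircleEnd) (h : ∀ t, (∀ c ∈ C, c t = 0) → φ t = 0) : φ ∈ C := by
  by_contra hφ
  have : CompactSpace C := isCompact_iff_compactSpace.1 hC.isCompact
  have : LocallyCompactSpace C := inferInstance
  let K : TopologicalSpace.PositiveCompacts C := ⊤
  let μ : Measure C := Measure.addHaarMeasure K
  have : IsProbabilityMeasure μ := ⟨by
    have := Measure.addHaarMeasure_self (K₀ := K)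
    simpa [K] using this⟩
  have hint : ∀ F : C(C, ℂ), Integrable F μ := fun F =>
    F.continuous.integrable_of_hasCompactSupport
      (HasCompactSupport.of_compactSpace F)
  -- `Λ ψ` averages a function over the coset `ψ + C`. The aim is `Λ φ = Λ 0`, which fails for a
  -- function separating the cosets `C` and `φ + C`.
  let sh : CircleEnd → C(C, CircleEnd) := fun ψ =>
    ⟨fun c => ψ + (c : CircleEnd), by fun_prop⟩
  let Λ : CircleEnd → C(CircleEnd, ℂ) →ₗ[ℂ] ℂ := fun ψ =>
    { toFun := fun F => ∫ c : C, F (ψ + c) ∂μ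
      map_add' := fun F G => integral_add (hint (F.comp (sh ψ))) (hint (G.comp (sh ψ)))
      map_smul' := fun a F => integral_const_mul a _ }
  have hΛ : ∀ ψ, Continuous (Λ ψ) := fun ψ => by
    refine (LinearMap.mkContinuous (Λ ψ) 1 fun F => ?_).continuous
    have := norm_integral_le_of_norm_le_const (μ := μ) (f := fun c : C => F (ψ + c)) (C := ‖F‖)
      (Filter.Eventually.of_forall fun c => F.norm_coe_le_norm _)
    rw [probReal_univ, mul_one] at this
    rw [one_mul]
    exact this
  have heq : ∀ F : C(CircleEnd, ℂ), Λ φ F = Λ 0 F := by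
    have hcl : IsClosed {F : C(CircleEnd, ℂ) | Λ φ F = Λ 0 F} := isClosed_eq (hΛ φ) (hΛ 0)
    have hd := dense_span_of_separatesPoints evalGroup (fun a b hab => by
      by_contra! hcon
      exact hab (AddMonoidHom.ext fun t => hcon (evalCircle t) ⟨t, rfl⟩))
    have hsub : (Submodule.span ℂ {f : C(CircleEnd, ℂ) | ∃ g : C(CircleEnd, Circle),
        g ∈ evalGroup ∧ ∀ x, f x = (g x : ℂ)}) ≤ LinearMap.eqLocus (Λ φ) (Λ 0) := by
      rw [Submodule.span_le]
      rintro f ⟨_, ⟨t, rfl⟩, hf⟩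
      change ∫ c : C, f (φ + c) ∂μ = ∫ c : C, f (0 + c) ∂μ
      simp only [hf]
      -- A character trivial on `C` is trivial at `φ` by hypothesis, so the two integrands agree;
      -- any other character has mean zero on every coset.
      by_cases ht : ∀ c ∈ C, c t = 0
      · have h1 := h t ht
        have h2 : ∀ c : C, evalCircle t (φ + c) = evalCircle t (0 + (c : CircleEnd)) := fun c => by
          change (φ t + (c : CircleEnd) t).toMul = ((0 : CircleEnd) t + (c : CircleEnd) t).toMul
          rw [h1]
          rfl
        simp only [h2]
      · push Not at ht
        obtain ⟨c, hc, hct⟩ := ht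
        have hz : ∫ x : C, (evalCircle t (x : CircleEnd) : ℂ) ∂μ = 0 :=
          integral_circle_eq_zero μ (fun x : C => evalCircle t (x : CircleEnd))
            (fun a b => rfl) ⟨c, hc⟩ (fun h' => hct (Additive.toMul.injective h'))
        have h3 : ∀ ψ : CircleEnd, ∫ x : C, (evalCircle t (ψ + x) : ℂ) ∂μ = 0 := fun ψ => by
          have : ∀ x : C, (evalCircle t (ψ + x) : ℂ) = evalCircle t ψ * evalCircle t (x : CircleEnd) :=
            fun x => by rw [← Circle.coe_mul]; rfl
          simp only [this, integral_const_mul, hz, mul_zero]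
        rw [h3, h3]
    intro F
    have : closure _ ⊆ _ := hcl.closure_subset_iff.2 hsub
    exact this (hd F)
  have hD : IsClosed ((fun c => φ + c) '' (C : Set CircleEnd)) :=
    (Homeomorph.addLeft φ).isClosedMap _ hC
  have hdisj : Disjoint (C : Set CircleEnd) ((fun c => φ + c) '' (C : Set CircleEnd)) := by
    rw [Set.disjoint_left]
    rintro _ hx ⟨c, hc, rfl⟩
    exact hφ (by simpa using C.sub_mem hx hc)
  obtain ⟨f, hf0, hf1, -⟩ := exists_continuous_zero_one_of_isClosed hC hD hdisj
  have h1 := heq ⟨fun x => (f x : ℂ), by fun_prop⟩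
  have h2 : ∀ c : C, f (φ + c) = 1 := fun c => hf1 ⟨c, c.2, rfl⟩
  have h3 : ∀ c : C, f (0 + c) = 0 := fun c => by rw [zero_add]; exact hf0 c.2
  change ∫ c : C, (f (φ + c) : ℂ) ∂μ = ∫ c : C, (f (0 + c) : ℂ) ∂μ at h1
  simp only [h2, h3] at h1
  simp at h1

end Annihilator

/-! ### Existence of endomorphisms of the circle -/

instance : DivisibleBy (Additive Circle) ℤ where
  div x n := Additive.ofMul (Circle.exp (Complex.arg (x.toMul : ℂ) / n))
  div_zero x := by simp
  div_cancel {n} x hn := by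
    have h : (n : ℝ) ≠ 0 := Int.cast_ne_zero.2 hn
    rw [← ofMul_zpow, ← Circle.exp_intCast_mul, mul_div_cancel₀ _ h]
    exact Circle.exp_arg x.toMul

/-- The map `n • t ↦ n • y` is well defined as `t` has infinite order, and it extends because
divisible groups are injective. -/
theorem exists_circleEnd_extension (t y : Additive Circle) (ht : ∀ n : ℤ, n • t = 0 → n = 0) :
    ∃ ψ : CircleEnd, ψ t = y := by
  obtain ⟨h, hh⟩ := (Module.Baer.of_divisible (Additive Circle)).extension_property_addMonoidHom
    (zmultiplesHom _ t) (by
      rw [injective_iff_map_eq_zero]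
      intro n hn
      exact ht n (by simpa using hn)) (zmultiplesHom _ y)
  refine ⟨h, ?_⟩
  have h1 : h ((1 : ℤ) • t) = (1 : ℤ) • y := DFunLike.congr_fun hh 1
  rw [one_smul, one_smul] at h1
  exact h1

/-- The embedding of the rational circle group into the circle. -/
def ratCircleHom : AddCircle (1 : ℚ) →+ Additive Circle :=
  QuotientAddGroup.lift _
    { toFun := fun q : ℚ => Additive.ofMul (Circle.exp (2 * Real.pi * (q : ℝ)))
      map_zero' := by simp
      map_add' := fun a b => by
        rw [← ofMul_mul, ← Circle.exp_add]
        push_cast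
        ring_nf }
    (by
      rintro _ ⟨n, rfl⟩
      have := Circle.exp_int_mul_two_pi n
      rw [mul_comm] at this
      simpa using this)

theorem ratCircleHom_injective : Function.Injective ratCircleHom := by
  rw [injective_iff_map_eq_zero]
  intro x hx
  induction x using QuotientAddGroup.induction_on with
  | H q =>
    have h1 : Circle.exp (2 * Real.pi * (q : ℝ)) = 1 := hx
    obtain ⟨n, hn⟩ := Circle.exp_eq_one.1 h1
    have h2 : (q : ℝ) = n := by
      have := Real.pi_pos
      have h3 : (2 * Real.pi) * (q : ℝ) = (2 * Real.pi) * n := by rw [hn]; ring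
      exact mul_left_cancel₀ (by positivity) h3
    have h4 : q = n := by exact_mod_cast h2
    exact (QuotientAddGroup.eq_zero_iff q).2 ⟨n, by simp [h4]⟩

/-- A character of the abstract quotient by `A` with values in `ℚ / ℤ` detects the class of `y`;
embedding `ℚ / ℤ` in the circle turns it into an endomorphism. -/
theorem exists_circleEnd_separating (A : AddSubgroup (Additive Circle)) (y : Additive Circle)
    (hy : y ∉ A) : ∃ ψ : CircleEnd, (∀ a ∈ A, ψ a = 0) ∧ ψ y ≠ 0 := by
  have hne : (QuotientAddGroup.mk' A y) ≠ 0 := fun h => hy ((QuotientAddGroup.eq_zero_iff y).1 h)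
  obtain ⟨c, hc⟩ := CharacterModule.exists_character_apply_ne_zero_of_ne_zero hne
  refine ⟨ratCircleHom.comp (AddMonoidHom.comp c (QuotientAddGroup.mk' A)), fun a ha => ?_,
    fun h => hc ?_⟩
  · have : QuotientAddGroup.mk' A a = 0 := (QuotientAddGroup.eq_zero_iff a).2 ha
    change ratCircleHom (c (QuotientAddGroup.mk' A a)) = 0
    rw [this, map_zero, map_zero]
  · exact (injective_iff_map_eq_zero _).1 ratCircleHom_injective _ h

theorem exists_circle_nontorsion : ∃ t : Additive Circle, ∀ n : ℤ, n • t = 0 → n = 0 := by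
  refine ⟨Additive.ofMul (Circle.exp 1), fun n hn => ?_⟩
  have h1 : Circle.exp (n : ℝ) = 1 := by
    have : Circle.exp 1 ^ n = 1 := hn
    rwa [← Circle.exp_intCast_mul, mul_one] at this
  obtain ⟨m, hm⟩ := Circle.exp_eq_one.1 h1
  by_contra hn0
  have hm0 : m ≠ 0 := by
    rintro rfl
    simp at hm
    exact hn0 hm
  apply irrational_pi
  refine ⟨(n : ℚ) / (2 * m), ?_⟩
  have : (m : ℝ) ≠ 0 := Int.cast_ne_zero.2 hm0
  push_cast
  rw [hm]
  field_simp

theorem exists_not_mem_zmultiples (t : Additive Circle) (ht : ∀ n : ℤ, n • t = 0 → n = 0)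
    (a : ℤ) (ha : a ≠ 0) : ∃ y : Additive Circle, a • y ∉ AddSubgroup.zmultiples t := by
  by_contra! h
  have h2 : 2 * a ≠ 0 := mul_ne_zero two_ne_zero ha
  -- For `y = t / (2a)`, a relation `a • y = m • t` doubles to `t = 2m • t`, impossible by parity
  -- since `t` has infinite order.
  obtain ⟨m, hm⟩ := h (DivisibleBy.div t (2 * a))
  change m • t = _ at hm
  have h3 : (2 * a) • DivisibleBy.div t (2 * a) = t := DivisibleBy.div_cancel t h2
  rw [mul_smul, ← hm, ← mul_smul] at h3
  have h4 := ht (2 * m - 1) (by rw [sub_smul, h3, one_smul, sub_self])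
  lia

/-- A nonzero closed group of endomorphisms of the circle is far from being central. -/
theorem exists_not_commute (C : AddSubgroup CircleEnd) (hC : IsClosed (C : Set CircleEnd))
    (hne : ∃ c ∈ C, c ≠ 0) (t : Additive Circle) (ht : ∀ n : ℤ, n • t = 0 → n = 0) :
    ∃ φ ∈ C, ∃ ψ : CircleEnd, φ (ψ t) ≠ ψ (φ t) := by
  by_contra! h
  -- If `φ t` lay outside `ℤ t`, an endomorphism killing `t` but not `φ t` would fail to commute
  -- with `φ` at `t`. So `φ t = a • t`, and since every `y` is some `ψ t`, `φ` is multiplication by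
  -- `a`.
  have hint : ∀ φ ∈ C, ∃ a : ℤ, φ = (a : CircleEnd) := by
    intro φ hφ
    have hmem : φ t ∈ AddSubgroup.zmultiples t := by
      by_contra hnot
      obtain ⟨ψ, hψ, hψne⟩ := exists_circleEnd_separating _ _ hnot
      apply hψne
      rw [← h φ hφ ψ, hψ t (AddSubgroup.mem_zmultiples t), map_zero]
    obtain ⟨a, ha⟩ := hmem
    change a • t = φ t at ha
    refine ⟨a, AddMonoidHom.ext fun y => ?_⟩
    obtain ⟨ψ, rfl⟩ := exists_circleEnd_extension t y ht
    exact (h φ hφ ψ).trans ((congrArg ψ ha.symm).trans (map_zsmul ψ a t))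
  obtain ⟨c, hc, hc0⟩ := hne
  obtain ⟨a, rfl⟩ := hint c hc
  have ha : a ≠ 0 := by
    rintro rfl
    simp at hc0
  obtain ⟨y, hy⟩ := exists_not_mem_zmultiples t ht a ha
  obtain ⟨ψ, rfl⟩ := exists_circleEnd_extension t y ht
  -- The annihilator of `C` lies in the `a`-torsion, which `ψ` preserves, so `aψ` belongs to `C`. It
  -- must then be an integer as well, against the choice of `y = ψ t`.
  have hmem : (a : CircleEnd) * ψ ∈ C := by
    refine mem_of_forall_annihilator C hC _ fun x hx => ?_
    have h1 : a • x = 0 := hx _ hc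
    change a • ψ x = 0
    rw [← map_zsmul, h1, map_zero]
  obtain ⟨b, hb⟩ := hint _ hmem
  exact hy ⟨b, (DFunLike.congr_fun hb t).symm⟩

/-! ### Power series over the endomorphism ring of the circle -/

/-- Power series with coefficients in the endomorphism ring of the circle; the sequence
`(φ₀, φ₁, …)` is encoded as `∑ φ_k X ^ k`, so that the shift becomes multiplication by `1 + X`. -/
abbrev EndSeries : Type := PowerSeries CircleEnd

instance : CompactSpace EndSeries := inferInstanceAs (CompactSpace ((Unit →₀ ℕ) → CircleEnd))

namespace EndSeries

theorem continuous_coeff (k : ℕ) : Continuous fun a : EndSeries => PowerSeries.coeff k a :=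
  PowerSeries.WithPiTopology.continuous_coeff _ k

theorem continuous_iff {Y : Type u} [TopologicalSpace Y] {f : Y → EndSeries} :
    Continuous f ↔ ∀ k : ℕ, Continuous fun y => PowerSeries.coeff k (f y) := by
  refine ⟨fun h k => (continuous_coeff k).comp h, fun h => ?_⟩
  rw [continuous_iff_continuousAt]
  intro y
  exact (PowerSeries.WithPiTopology.tendsto_iff_coeff_tendsto _ _ _ _).2
    fun k => (h k).continuousAt

theorem continuous_mul_right (b : EndSeries) : Continuous fun a : EndSeries => a * b := by
  rw [continuous_iff]
  intro k
  simp only [PowerSeries.coeff_mul]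
  exact continuous_finsetSum _ fun p _ =>
    (CircleEnd.continuous_mul_right _).comp (continuous_coeff p.1)

/-- The unit `1 + X`. -/
def shiftUnit : EndSeriesˣ :=
  IsUnit.unit (a := (1 + PowerSeries.X : EndSeries))
    (MvPowerSeries.isUnit_iff_constantCoeff.2 (by
      change IsUnit (PowerSeries.constantCoeff (1 + PowerSeries.X : EndSeries))
      simp))

theorem coe_shiftUnit : (shiftUnit : EndSeries) = 1 + PowerSeries.X := rfl

theorem commute_shiftUnit (a : EndSeries) (n : ℤ) :
    Commute a ((shiftUnit ^ n : EndSeriesˣ) : EndSeries) := by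
  have h : Commute a (shiftUnit : EndSeries) :=
    (Commute.one_right a).add_right (PowerSeries.commute_X a)
  exact h.units_zpow_right n

/-- The closure of the powers of `1 + X`. -/
def orbitClosure : Set EndSeries :=
  closure (Set.range fun n : ℤ => ((shiftUnit ^ n : EndSeriesˣ) : EndSeries))

theorem isClosed_orbitClosure : IsClosed orbitClosure := isClosed_closure

theorem zpow_mem_orbitClosure (n : ℤ) :
    ((shiftUnit ^ n : EndSeriesˣ) : EndSeries) ∈ orbitClosure :=
  subset_closure ⟨n, rfl⟩

theorem one_mem_orbitClosure : (1 : EndSeries) ∈ orbitClosure := zpow_mem_orbitClosure 0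

theorem zpow_mul_mem_orbitClosure (n : ℤ) {b : EndSeries} (hb : b ∈ orbitClosure) :
    ((shiftUnit ^ n : EndSeriesˣ) : EndSeries) * b ∈ orbitClosure := by
  -- Powers of `1 + X` are central, so this left multiplication is a right multiplication and hence
  -- continuous.
  rw [← (commute_shiftUnit b n).eq]
  refine map_mem_closure (f := fun c => c * ((shiftUnit ^ n : EndSeriesˣ) : EndSeries))
    (continuous_mul_right _) hb ?_
  rintro _ ⟨m, rfl⟩
  exact ⟨m + n, by simp [zpow_add]⟩

theorem mul_mem_orbitClosure {a b : EndSeries} (ha : a ∈ orbitClosure) (hb : b ∈ orbitClosure) :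
    a * b ∈ orbitClosure := by
  have := map_mem_closure (continuous_mul_right b) ha (t := orbitClosure) (by
    rintro _ ⟨n, rfl⟩
    exact zpow_mul_mem_orbitClosure n hb)
  rwa [isClosed_orbitClosure.closure_eq] at this

theorem coeff_zero_shiftUnit_zpow (n : ℤ) :
    PowerSeries.coeff 0 ((shiftUnit ^ n : EndSeriesˣ) : EndSeries) = 1 := by
  have h : Units.map (PowerSeries.constantCoeff (R := CircleEnd)).toMonoidHom shiftUnit = 1 := by
    ext1
    simp [coe_shiftUnit]
  have h2 := congrArg (· ^ n) h
  simp only [← map_zpow, one_zpow] at h2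
  rw [PowerSeries.coeff_zero_eq_constantCoeff_apply]
  exact congrArg Units.val h2

theorem coeff_zero_of_mem {a : EndSeries} (ha : a ∈ orbitClosure) :
    PowerSeries.coeff 0 a = 1 := by
  have hcl : IsClosed {a : EndSeries | PowerSeries.coeff 0 a = 1} :=
    isClosed_eq (continuous_coeff 0) continuous_const
  refine (hcl.closure_subset_iff.2 ?_) ha
  rintro _ ⟨n, rfl⟩
  exact coeff_zero_shiftUnit_zpow n

theorem isUnit_of_coeff_zero {a : EndSeries} (ha : PowerSeries.coeff 0 a = 1) : IsUnit a := by
  refine MvPowerSeries.isUnit_iff_constantCoeff.2 ?_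
  change IsUnit (PowerSeries.constantCoeff a)
  rw [← PowerSeries.coeff_zero_eq_constantCoeff_apply, ha]
  exact isUnit_one

/-- The set `orbitClosure * a` is a compact semigroup, so it contains an idempotent. Constant
coefficient `1` makes that idempotent a unit, hence equal to `1`. -/
theorem exists_left_inverse {a : EndSeries} (ha : a ∈ orbitClosure) :
    ∃ b ∈ orbitClosure, b * a = 1 := by
  have hcont := continuous_mul_right a
  obtain ⟨p, ⟨b, hb, rfl⟩, hp⟩ := exists_idempotent_in_compact_subsemigroup
    (fun r : EndSeries => continuous_mul_right r) ((· * a) '' orbitClosure)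
    ⟨_, 1, one_mem_orbitClosure, rfl⟩ (isClosed_orbitClosure.isCompact.image hcont) (by
      rintro _ ⟨x, hx, rfl⟩ _ ⟨y, hy, rfl⟩
      exact ⟨x * a * y, mul_mem_orbitClosure (mul_mem_orbitClosure hx ha) hy, mul_assoc _ _ _⟩)
  refine ⟨b, hb, ?_⟩
  have hu := isUnit_of_coeff_zero (coeff_zero_of_mem (mul_mem_orbitClosure hb ha))
  exact hu.mul_left_cancel (hp.trans (mul_one _).symm)

/-- Closed subsets of the power series ring that are groups under multiplication. -/
structure IsClosedSubgroup (N : Set EndSeries) : Prop where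
  isClosed : IsClosed N
  one_mem : 1 ∈ N
  mul_mem : ∀ {a b}, a ∈ N → b ∈ N → a * b ∈ N
  inv_mem : ∀ a ∈ N, ∃ b ∈ N, a * b = 1 ∧ b * a = 1

theorem isClosedSubgroup_orbitClosure : IsClosedSubgroup orbitClosure where
  isClosed := isClosed_orbitClosure
  one_mem := one_mem_orbitClosure
  mul_mem := mul_mem_orbitClosure
  inv_mem a ha := by
    obtain ⟨b, hb, hba⟩ := exists_left_inverse ha
    obtain ⟨c, -, hcb⟩ := exists_left_inverse hb
    have : c = a := by rw [← mul_one c, ← hba, ← mul_assoc, hcb, one_mul]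
    exact ⟨b, hb, this ▸ hcb, hba⟩

/-! ### The filtration by levels -/

/-- The power series that are congruent to `1` modulo `X ^ m`. -/
def level (m : ℕ) : Set EndSeries := {a | ∃ b, a = 1 + PowerSeries.X ^ m * b}

theorem mem_level_iff {m : ℕ} {a : EndSeries} :
    a ∈ level m ↔ ∀ k < m, PowerSeries.coeff k a = PowerSeries.coeff k (1 : EndSeries) := by
  have h : a ∈ level m ↔ PowerSeries.X ^ m ∣ a - 1 :=
    ⟨fun ⟨b, hb⟩ => ⟨b, by rw [hb, add_sub_cancel_left]⟩,
      fun ⟨b, hb⟩ => ⟨b, by rw [← hb, add_sub_cancel]⟩⟩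
  rw [h, PowerSeries.X_pow_dvd_iff]
  simp only [map_sub, sub_eq_zero]

theorem isClosed_level (m : ℕ) : IsClosed (level m) := by
  have : level m = ⋂ (k : ℕ) (_ : k < m),
      {a : EndSeries | PowerSeries.coeff k a = PowerSeries.coeff k (1 : EndSeries)} := by
    ext a
    simp [mem_level_iff]
  rw [this]
  exact isClosed_biInter fun k _ => isClosed_eq (continuous_coeff k) continuous_const

theorem level_one_of_mem {a : EndSeries} (ha : a ∈ orbitClosure) : a ∈ level 1 := by
  rw [mem_level_iff]
  intro k hk
  obtain rfl : k = 0 := by lia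
  rw [coeff_zero_of_mem ha]
  simp

theorem coeff_one_add (m : ℕ) (b : EndSeries) :
    PowerSeries.coeff (m + 1) (1 + PowerSeries.X ^ (m + 1) * b) = PowerSeries.coeff 0 b := by
  rw [map_add, PowerSeries.coeff_one, if_neg (Nat.succ_ne_zero m), zero_add]
  simpa using PowerSeries.coeff_X_pow_mul b (m + 1) 0

theorem one_add_mul_one_add (m : ℕ) (a b : EndSeries) :
    (1 + PowerSeries.X ^ m * a) * (1 + PowerSeries.X ^ m * b) =
      1 + PowerSeries.X ^ m * (a + b + PowerSeries.X ^ m * (a * b)) := by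
  have h : PowerSeries.X ^ m * a * (PowerSeries.X ^ m * b) =
      PowerSeries.X ^ m * (PowerSeries.X ^ m * (a * b)) := by
    rw [mul_assoc, ← mul_assoc a, (PowerSeries.commute_X_pow a m).eq, mul_assoc _ a b]
  rw [mul_add, add_mul, add_mul, h]
  simp only [one_mul, mul_one, mul_add]
  abel

theorem mul_mem_level {m : ℕ} {a b : EndSeries} (ha : a ∈ level m) (hb : b ∈ level m) :
    a * b ∈ level m := by
  obtain ⟨a, rfl⟩ := ha
  obtain ⟨b, rfl⟩ := hb
  exact ⟨_, one_add_mul_one_add m a b⟩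

theorem coeff_mul_of_mem_level {m : ℕ} {a b : EndSeries} (ha : a ∈ level (m + 1))
    (hb : b ∈ level (m + 1)) : PowerSeries.coeff (m + 1) (a * b) =
      PowerSeries.coeff (m + 1) a + PowerSeries.coeff (m + 1) b := by
  obtain ⟨a, rfl⟩ := ha
  obtain ⟨b, rfl⟩ := hb
  rw [one_add_mul_one_add, coeff_one_add, coeff_one_add, coeff_one_add]
  simp

theorem eq_one_add_mul_neg {R : Type u} [Ring R] (x a b : R) (h : (1 + x * a) * b = 1) :
    b = 1 + x * -(a * b) := by
  rw [mul_neg, ← mul_assoc, eq_add_neg_iff_add_eq, ← h, add_mul, one_mul]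

theorem inv_mem_level {m : ℕ} {a b : EndSeries} (ha : a ∈ level m) (hab : a * b = 1) :
    b ∈ level m := by
  obtain ⟨a, rfl⟩ := ha
  exact ⟨-(a * b), eq_one_add_mul_neg _ a b hab⟩

/-- The group of the leading coefficients, at `X ^ (m + 1)`, of the members of `N`. -/
def leadingGroup {N : Set EndSeries} (hN : IsClosedSubgroup N) (m : ℕ) :
    AddSubgroup CircleEnd where
  carrier := PowerSeries.coeff (m + 1) '' (N ∩ level (m + 1))
  zero_mem' := ⟨1, ⟨hN.one_mem, 0, by simp⟩, by simp [PowerSeries.coeff_one]⟩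
  add_mem' := by
    rintro _ _ ⟨a, ⟨ha, ha'⟩, rfl⟩ ⟨b, ⟨hb, hb'⟩, rfl⟩
    exact ⟨a * b, ⟨hN.mul_mem ha hb, mul_mem_level ha' hb'⟩, coeff_mul_of_mem_level ha' hb'⟩
  neg_mem' := by
    rintro _ ⟨a, ⟨ha, ha'⟩, rfl⟩
    obtain ⟨b, hb, hab, -⟩ := hN.inv_mem a ha
    have hb' := inv_mem_level ha' hab
    refine ⟨b, ⟨hb, hb'⟩, eq_neg_of_add_eq_zero_right ?_⟩
    rw [← coeff_mul_of_mem_level ha' hb', hab]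
    simp [PowerSeries.coeff_one]

theorem mem_leadingGroup {N : Set EndSeries} (hN : IsClosedSubgroup N) {m : ℕ} {φ : CircleEnd} :
    φ ∈ leadingGroup hN m ↔ ∃ a ∈ N, a ∈ level (m + 1) ∧ PowerSeries.coeff (m + 1) a = φ :=
  ⟨fun ⟨a, ⟨h1, h2⟩, h3⟩ => ⟨a, h1, h2, h3⟩, fun ⟨a, h1, h2, h3⟩ => ⟨a, ⟨h1, h2⟩, h3⟩⟩

theorem isClosed_leadingGroup {N : Set EndSeries} (hN : IsClosedSubgroup N) (m : ℕ) :
    IsClosed (leadingGroup hN m : Set CircleEnd) :=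
  ((hN.isClosed.inter (isClosed_level (m + 1))).isCompact.image (continuous_coeff _)).isClosed

/-- The element `1 + X` contributes the identity endomorphism, which annihilates only `t = 0`; by
duality the closed leading group is everything. -/
theorem leadingGroup_orbitClosure (φ : CircleEnd) :
    φ ∈ leadingGroup isClosedSubgroup_orbitClosure 0 := by
  refine mem_of_forall_annihilator _ (isClosed_leadingGroup _ 0) φ fun t ht => ?_
  have h1 : (1 : CircleEnd) ∈ leadingGroup isClosedSubgroup_orbitClosure 0 := by
    have hmem := zpow_mem_orbitClosure 1
    rw [zpow_one] at hmem
    exact (mem_leadingGroup _).2 ⟨_, hmem, level_one_of_mem hmem, by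
      simp [coe_shiftUnit, PowerSeries.coeff_one]⟩
  have h2 : t = 0 := ht _ h1
  rw [h2, map_zero]

theorem exists_mem_orbitClosure_coeff_one (φ : CircleEnd) :
    ∃ a ∈ orbitClosure, PowerSeries.coeff 1 a = φ := by
  obtain ⟨a, h1, -, h3⟩ := (mem_leadingGroup _).1 (leadingGroup_orbitClosure φ)
  exact ⟨a, h1, h3⟩

/-- `N` is normalised by the closure of the powers of `1 + X`. -/
def IsNormalised (N : Set EndSeries) : Prop :=
  ∀ ν ∈ N, ∀ κ ∈ orbitClosure, ∀ κ' ∈ orbitClosure, κ * κ' = 1 → κ' * κ = 1 → κ * ν * κ' ∈ N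

theorem commutator_mem_leadingGroup {N : Set EndSeries} (hN : IsClosedSubgroup N)
    (hnorm : IsNormalised N) (m : ℕ) {φ : CircleEnd} (hφ : φ ∈ leadingGroup hN m)
    (ψ : CircleEnd) : φ * ψ - ψ * φ ∈ leadingGroup hN (m + 1) := by
  obtain ⟨ν, hν, ⟨b, hb⟩, hνφ⟩ := (mem_leadingGroup hN).1 hφ
  obtain ⟨κ, hκ, hκψ⟩ := exists_mem_orbitClosure_coeff_one ψ
  obtain ⟨κ', hκ', h1, h2⟩ := isClosedSubgroup_orbitClosure.inv_mem κ hκ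
  obtain ⟨ν', hν', h3, h4⟩ := hN.inv_mem ν hν
  have hκ0 := coeff_zero_of_mem hκ
  have hκ0' := coeff_zero_of_mem hκ'
  have hν0' : PowerSeries.coeff 0 ν' = 1 := by
    have := mem_level_iff.1 (inv_mem_level ⟨b, hb⟩ h3) 0 (Nat.succ_pos m)
    simpa using this
  have hb0 : PowerSeries.coeff 0 b = φ := by rw [← hνφ, hb, coeff_one_add]
  -- As `κ` has constant coefficient `1`, the constant terms cancel. This gains one power of `X` in
  -- `νκ - κν`, and hence in the group commutator, with leading coefficient `φψ - ψφ`.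
  obtain ⟨d, hd⟩ : PowerSeries.X ∣ b * κ - κ * b := by
    rw [PowerSeries.X_dvd_iff]
    rw [PowerSeries.coeff_zero_eq_constantCoeff_apply] at hκ0
    simp [hκ0]
  have hd0 : PowerSeries.coeff 0 d = φ * ψ - ψ * φ := by
    have : PowerSeries.coeff 1 (b * κ - κ * b) = PowerSeries.coeff 1 (PowerSeries.X * d) := by
      rw [hd]
    rw [PowerSeries.coeff_succ_X_mul] at this
    rw [← this]
    have h6 : ∀ x y : EndSeries, PowerSeries.coeff 1 (x * y) =
        PowerSeries.coeff 0 x * PowerSeries.coeff 1 y +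
          PowerSeries.coeff 1 x * PowerSeries.coeff 0 y := fun x y => by
      rw [PowerSeries.coeff_mul, Finset.Nat.sum_antidiagonal_eq_sum_range_succ_mk]
      simp [Finset.sum_range_succ]
    rw [map_sub, h6, h6, hκ0, hκψ, hb0, mul_one, one_mul]
    abel
  have hcomm : ν * κ - κ * ν = PowerSeries.X ^ (m + 2) * d := by
    have hX := (PowerSeries.commute_X_pow κ (m + 1)).eq
    rw [hb, add_mul, mul_add, one_mul, mul_one, ← mul_assoc κ, hX, mul_assoc, mul_assoc,
      add_sub_add_left_eq_sub, ← mul_sub, hd, ← mul_assoc, ← pow_succ]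
  refine (mem_leadingGroup hN).2 ⟨ν * (κ * ν' * κ'),
    hN.mul_mem hν (hnorm ν' hν' κ hκ κ' hκ' h1 h2), ?_⟩
  have hc : ν * (κ * ν' * κ') = 1 + PowerSeries.X ^ (m + 2) * (d * ν' * κ') := by
    have h5 : κ * ν * (ν' * κ') = 1 := by
      rw [mul_assoc, ← mul_assoc ν, h3, one_mul, h1]
    calc ν * (κ * ν' * κ') = κ * ν * (ν' * κ') + (ν * κ - κ * ν) * (ν' * κ') := by
          rw [sub_mul, add_sub_cancel]; simp only [mul_assoc]
      _ = _ := by rw [h5, hcomm]; simp only [mul_assoc]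
  refine ⟨⟨_, hc⟩, ?_⟩
  rw [hc, coeff_one_add]
  rw [PowerSeries.coeff_zero_eq_constantCoeff_apply] at hd0 hν0' hκ0' ⊢
  simp [hd0, hν0', hκ0']

/-- The endomorphism `φ` vanishes on the torsion of the circle. -/
def KillsTorsion (φ : CircleEnd) : Prop :=
  ∀ (t : Additive Circle) (n : ℤ), n ≠ 0 → n • t = 0 → φ t = 0

theorem exists_killsTorsion_ne_zero : ∃ φ : CircleEnd, KillsTorsion φ ∧ φ ≠ 0 := by
  obtain ⟨t, ht⟩ := exists_circle_nontorsion
  obtain ⟨φ, hφ, hφt⟩ := exists_circleEnd_separating (AddCommGroup.torsion _) t (by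
    intro h
    obtain ⟨n, hn, hnt⟩ := isOfFinAddOrder_iff_nsmul_eq_zero.1 h
    have := ht n (by simpa using hnt)
    lia)
  refine ⟨φ, fun x n hn hx => hφ x ?_, fun h => hφt (by rw [h]; rfl)⟩
  exact isOfFinAddOrder_iff_zsmul_eq_zero.2 ⟨n, hn, hx⟩

/-- By `exists_not_commute`, some commutator in the next leading group is nonzero at any given `t`
of infinite order. The annihilator of that group is therefore torsion, and `φ` vanishes on it. -/
theorem mem_leadingGroup_succ {N : Set EndSeries} (hN : IsClosedSubgroup N)
    (hnorm : IsNormalised N) (m : ℕ) (hne : ∃ φ ∈ leadingGroup hN m, φ ≠ 0) {φ : CircleEnd}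
    (hφ : KillsTorsion φ) : φ ∈ leadingGroup hN (m + 1) := by
  refine mem_of_forall_annihilator _ (isClosed_leadingGroup hN _) φ fun t ht => ?_
  by_cases htor : ∀ n : ℤ, n • t = 0 → n = 0
  · obtain ⟨c, hc, ψ, hψ⟩ := exists_not_commute _ (isClosed_leadingGroup hN m) hne t htor
    exact absurd (sub_eq_zero.1 (ht _ (commutator_mem_leadingGroup hN hnorm m hc ψ))) hψ
  · push Not at htor
    obtain ⟨n, hn, hn0⟩ := htor
    exact hφ t n hn0 hn

theorem mem_leadingGroup_of_lt {N : Set EndSeries} (hN : IsClosedSubgroup N)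
    (hnorm : IsNormalised N) (m : ℕ) (hne : ∃ φ ∈ leadingGroup hN m, φ ≠ 0) (k : ℕ)
    {φ : CircleEnd} (hφ : KillsTorsion φ) : φ ∈ leadingGroup hN (m + 1 + k) := by
  induction k generalizing φ with
  | zero => exact mem_leadingGroup_succ hN hnorm m hne hφ
  | succ k ih =>
    -- A nonzero endomorphism killing torsion keeps the leading group nonzero at each step.
    obtain ⟨ψ, hψ, hψ0⟩ := exists_killsTorsion_ne_zero
    exact mem_leadingGroup_succ hN hnorm (m + 1 + k) ⟨ψ, ih hψ, hψ0⟩ hφ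

end EndSeries

namespace EndSeries

/-! ### The system `𝓗` inside the power series ring -/

/-- An endomorphism of the circle, written multiplicatively. -/
def ofEnd (φ : CircleEnd) : EndCircle := MonoidHom.toAdditive.symm φ

/-- The sequence of coefficients of a power series. -/
def toSeq (a : EndSeries) : ℕ → EndCircle := fun k => ofEnd (PowerSeries.coeff k a)

/-- The power series with given coefficients. -/
def ofSeq (φ : ℕ → EndCircle) : EndSeries := PowerSeries.mk fun k => toEnd (φ k)

theorem toSeq_ofSeq (φ : ℕ → EndCircle) : toSeq (ofSeq φ) = φ := by
  funext k
  rw [toSeq, ofSeq, PowerSeries.coeff_mk]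
  rfl

theorem toEnd_toSeq (a : EndSeries) (k : ℕ) : toEnd (toSeq a k) = PowerSeries.coeff k a := rfl

theorem continuous_ofSeq : Continuous ofSeq := by
  rw [continuous_iff]
  intro k
  simp only [ofSeq, PowerSeries.coeff_mk]
  rw [CircleEnd.continuous_iff]
  intro t
  have h1 : Continuous fun φ : EndCircle => φ t.toMul :=
    (continuous_apply t.toMul).comp continuous_induced_dom
  exact h1.comp (continuous_apply k)

theorem toSeq_shiftUnit_mul (a : EndSeries) :
    toSeq ((shiftUnit : EndSeries) * a) = shiftFun (toSeq a) := by
  funext k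
  apply MonoidHom.toAdditive.injective
  change PowerSeries.coeff k ((shiftUnit : EndSeries) * a) = _
  rw [coe_shiftUnit, add_mul, one_mul, map_add]
  cases k with
  | zero =>
    rw [PowerSeries.coeff_zero_X_mul, add_zero]
    rfl
  | succ k =>
    rw [PowerSeries.coeff_succ_X_mul, add_comm]
    rfl

/-- The power series whose coefficient sequence belongs to `𝓗`. -/
def seriesH : Set EndSeries := {a | toSeq a ∈ spaceH}

theorem finite_torsion (n : ℤ) (hn : n ≠ 0) : {y : Additive Circle | n • y = 0}.Finite := by
  have h1 : {z : ℂ | z ^ n.natAbs = 1}.Finite :=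
    (Polynomial.nthRootsFinset n.natAbs (1 : ℂ)).finite_toSet.subset fun z hz => by
      simpa [Polynomial.mem_nthRootsFinset (Int.natAbs_pos.2 hn)] using hz
  have hinj : Function.Injective fun y : Additive Circle => (y.toMul : ℂ) :=
    fun y z h => Additive.toMul.injective (Circle.ext h)
  have h2 := h1.preimage hinj.injOn
  refine h2.subset fun y hy => ?_
  change n • y = 0 at hy
  have h3 : n.natAbs • y = 0 := natAbs_nsmul_eq_zero.2 hy
  change (y.toMul : ℂ) ^ n.natAbs = 1
  rw [← Circle.coe_pow]
  exact congrArg (fun x : Circle => (x : ℂ)) h3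

theorem isOfFinAddOrder_apply (φ : CircleEnd) {t : Additive Circle} (ht : IsOfFinAddOrder t) :
    IsOfFinAddOrder (φ t) := AddMonoidHom.isOfFinAddOrder φ ht

/-- If `n • t = 0`, all values at `t` lie in the finite `n`-torsion, so evaluation at `t` is locally
constant. This makes iterates continuous at torsion points, although composition is not jointly
continuous, and is why `seriesH` is closed. -/
theorem eventually_eq_of_torsion (φ : CircleEnd) {t : Additive Circle}
    (ht : IsOfFinAddOrder t) : ∀ᶠ ψ in 𝓝 φ, ψ t = φ t := by
  obtain ⟨n, hn, hnt⟩ := isOfFinAddOrder_iff_zsmul_eq_zero.1 ht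
  have hfin : ({y : Additive Circle | n • y = 0} \ {φ t}).Finite :=
    (finite_torsion n hn).subset Set.sdiff_subset
  have hopen := (CircleEnd.continuous_eval t).isOpen_preimage _ hfin.isClosed.isOpen_compl
  filter_upwards [hopen.mem_nhds (show φ ∈ _ by simp)] with ψ hψ
  by_contra hne
  refine hψ ⟨?_, hne⟩
  change n • ψ t = 0
  exact ((map_zsmul ψ n t).symm.trans (congrArg ψ hnt)).trans (map_zero ψ)

theorem continuous_pow_apply (j : ℕ) {t : Additive Circle} (ht : IsOfFinAddOrder t) :
    Continuous fun φ : CircleEnd => (φ ^ j) t := by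
  induction j generalizing t with
  | zero => exact continuous_const
  | succ j ih =>
    rw [continuous_iff_continuousAt]
    intro φ
    refine (ih (isOfFinAddOrder_apply φ ht)).continuousAt.congr ?_
    filter_upwards [eventually_eq_of_torsion φ ht] with ψ hψ
    rw [← hψ, pow_succ]
    rfl

theorem aeval_apply_eq_sum (φ : CircleEnd) (p : ℤ[X]) (t : Additive Circle) :
    aeval φ p t = ∑ j ∈ Finset.range (p.natDegree + 1), p.coeff j • (φ ^ j) t := by
  rw [aeval_eq_sum_range]
  exact AddMonoidHom.finsetSum_apply _ _ _

theorem continuous_aeval_apply (p : ℤ[X]) {t : Additive Circle} (ht : IsOfFinAddOrder t) :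
    Continuous fun φ : CircleEnd => aeval φ p t := by
  simp only [aeval_apply_eq_sum]
  exact continuous_finsetSum _ fun j _ => (continuous_pow_apply j ht).zsmul _

theorem mem_rationalCircle_iff (x : Circle) :
    x ∈ rationalCircle ↔ IsOfFinAddOrder (Additive.ofMul x) := by
  rw [isOfFinAddOrder_iff_zsmul_eq_zero]
  constructor
  · rintro ⟨q, rfl⟩
    refine ⟨q.den, by exact_mod_cast q.den_ne_zero, ?_⟩
    have hq : (q.den : ℝ) * q = q.num := by exact_mod_cast Rat.den_mul_eq_num q
    have h : Circle.exp (2 * Real.pi * (q : ℝ)) ^ (q.den : ℤ) = 1 := by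
      rw [← Circle.exp_intCast_mul, Circle.exp_eq_one]
      refine ⟨q.num, ?_⟩
      rw [← hq]
      push_cast
      ring
    exact h
  · rintro ⟨n, hn, h⟩
    have h1 : Circle.exp ((n : ℝ) * Complex.arg (x : ℂ)) = 1 := by
      rw [Circle.exp_intCast_mul, Circle.exp_arg]
      exact h
    obtain ⟨m, hm⟩ := Circle.exp_eq_one.1 h1
    refine ⟨(m : ℚ) / n, ?_⟩
    rw [← Circle.exp_arg x]
    congr 1
    have hn' : (n : ℝ) ≠ 0 := Int.cast_ne_zero.2 hn
    push_cast
    field_simp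
    rw [mul_comm, hm]
    ring

theorem mem_seriesH_iff (a : EndSeries) : a ∈ seriesH ↔ PowerSeries.coeff 0 a = 1 ∧
    ∀ (k : ℕ) (t : Additive Circle), IsOfFinAddOrder t → PowerSeries.coeff k a (k.factorial • t) =
      aeval (PowerSeries.coeff 1 a) (descPochhammer ℤ k) t := by
  change toSeq a ∈ spaceH ↔ _
  rw [mem_spaceH_iff]
  refine and_congr ⟨fun h => ?_, fun h => ?_⟩ ⟨fun h k t ht => ?_, fun h k x hx => ?_⟩
  · rw [← toEnd_toSeq, h]
    rfl
  · apply MonoidHom.toAdditive.injective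
    exact h
  · exact h k t.toMul ((mem_rationalCircle_iff _).2 ht)
  · exact h k _ ((mem_rationalCircle_iff x).1 hx)

theorem isClosed_seriesH : IsClosed seriesH := by
  have : seriesH = {a : EndSeries | PowerSeries.coeff 0 a = 1} ∩
      ⋂ (k : ℕ) (t : Additive Circle) (_ : IsOfFinAddOrder t),
        {a : EndSeries | PowerSeries.coeff k a (k.factorial • t) =
          aeval (PowerSeries.coeff 1 a) (descPochhammer ℤ k) t} := by
    ext a
    rw [mem_seriesH_iff]
    simp only [Set.mem_inter_iff, Set.mem_iInter, Set.mem_ofPred_eq]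
  rw [this]
  refine (isClosed_eq (continuous_coeff 0) continuous_const).inter
    (isClosed_iInter fun k => isClosed_iInter fun t => isClosed_iInter fun ht =>
      isClosed_eq ((CircleEnd.continuous_eval _).comp (continuous_coeff k))
        ((continuous_aeval_apply _ ht).comp (continuous_coeff 1)))

theorem one_mem_seriesH : (1 : EndSeries) ∈ seriesH := by
  rw [mem_seriesH_iff]
  refine ⟨by simp, fun k t _ => ?_⟩
  have h1 : PowerSeries.coeff 1 (1 : EndSeries) = 0 := by simp [PowerSeries.coeff_one]
  rw [h1, ← coeff_zero_eq_aeval_zero', coeff_zero_eq_eval_zero, descPochhammer_eval_zero,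
    PowerSeries.coeff_one]
  split_ifs with hk
  · subst hk
    simp
  · simp

theorem shiftUnit_mul_mem_seriesH_iff (a : EndSeries) :
    (shiftUnit : EndSeries) * a ∈ seriesH ↔ a ∈ seriesH := by
  change toSeq _ ∈ spaceH ↔ _
  rw [toSeq_shiftUnit_mul, shift_mem_spaceH_iff]
  rfl

theorem orbitClosure_subset_seriesH : orbitClosure ⊆ seriesH := by
  refine isClosed_seriesH.closure_subset_iff.2 ?_
  rintro _ ⟨n, rfl⟩
  induction n using Int.induction_on with
  | zero => exact one_mem_seriesH
  | succ n ih =>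
    have := (shiftUnit_mul_mem_seriesH_iff _).2 ih
    rwa [← Units.val_mul, ← zpow_one_add, add_comm] at this
  | pred n ih =>
    rw [← shiftUnit_mul_mem_seriesH_iff]
    simp only [← Units.val_mul, ← zpow_one_add]
    convert ih using 3
    ring

/-- Writing a torsion point as `k! • y` with `y` torsion, the defining relation of `𝓗` expresses the
`k`-th coefficient there through iterates of the first one. -/
theorem coeff_eq_of_torsion {a b : EndSeries} (ha : a ∈ seriesH) (hb : b ∈ seriesH)
    (h : ∀ t, IsOfFinAddOrder t → PowerSeries.coeff 1 a t = PowerSeries.coeff 1 b t) (k : ℕ)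
    (t : Additive Circle) (ht : IsOfFinAddOrder t) :
    PowerSeries.coeff k a t = PowerSeries.coeff k b t := by
  have hk : (k.factorial : ℤ) ≠ 0 := by exact_mod_cast k.factorial_ne_zero
  set y : Additive Circle := DivisibleBy.div t (k.factorial : ℤ) with hy
  have hyt : k.factorial • y = t := by
    have : (k.factorial : ℤ) • y = t := DivisibleBy.div_cancel t hk
    simpa using this
  have hy' : IsOfFinAddOrder y := by
    obtain ⟨n, hn, hnt⟩ := isOfFinAddOrder_iff_nsmul_eq_zero.1 ht
    refine isOfFinAddOrder_iff_nsmul_eq_zero.2 ⟨n * k.factorial, by positivity, ?_⟩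
    rw [mul_smul, hyt, hnt]
  have hpow : ∀ (j : ℕ) (x : Additive Circle), IsOfFinAddOrder x →
      (PowerSeries.coeff 1 a ^ j) x = (PowerSeries.coeff 1 b ^ j) x := by
    intro j
    induction j with
    | zero => intro x _; rfl
    | succ j ih =>
      intro x hx
      rw [pow_succ, pow_succ, CircleEnd.mul_apply, CircleEnd.mul_apply, ← h x hx]
      exact ih _ (isOfFinAddOrder_apply _ hx)
  rw [← hyt, ((mem_seriesH_iff a).1 ha).2 k y hy', ((mem_seriesH_iff b).1 hb).2 k y hy',
    aeval_apply_eq_sum, aeval_apply_eq_sum]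
  exact Finset.sum_congr rfl fun j _ => by rw [hpow j y hy']

theorem killsTorsion_iff {φ : CircleEnd} :
    KillsTorsion φ ↔ ∀ t, IsOfFinAddOrder t → φ t = 0 := by
  constructor
  · intro h t ht
    obtain ⟨n, hn, hnt⟩ := isOfFinAddOrder_iff_zsmul_eq_zero.1 ht
    exact h t n hn hnt
  · intro h t n hn hnt
    exact h t (isOfFinAddOrder_iff_zsmul_eq_zero.2 ⟨n, hn, hnt⟩)

theorem killsTorsion_coeff_mul {a b c : EndSeries} (ha : a ∈ seriesH) (hb : b ∈ seriesH)
    (h : ∀ t, IsOfFinAddOrder t → PowerSeries.coeff 1 a t = PowerSeries.coeff 1 b t)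
    (hcb : c * b = 1) (k : ℕ) (hk : k ≠ 0) : KillsTorsion (PowerSeries.coeff k (c * a)) := by
  rw [killsTorsion_iff]
  intro t ht
  -- All coefficients of `a - b` vanish on torsion, and multiplying by `c` on the left preserves
  -- this.
  have h1 : c * a = 1 + c * (a - b) := by rw [mul_sub, hcb, add_sub_cancel]
  rw [h1, map_add, PowerSeries.coeff_one, if_neg hk, zero_add, PowerSeries.coeff_mul]
  have h2 : ∀ (S : Finset (ℕ × ℕ)) (F : ℕ × ℕ → CircleEnd),
      (∑ j ∈ S, F j) t = ∑ j ∈ S, F j t := fun S F => AddMonoidHom.finsetSum_apply F S t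
  rw [h2]
  refine Finset.sum_eq_zero fun p _ => ?_
  rw [CircleEnd.mul_apply, map_sub, CircleEnd.sub_apply, coeff_eq_of_torsion ha hb h p.2 t ht,
    sub_self]
  exact map_zero _

theorem killsTorsion_coeff_of_mem_level {a : EndSeries} (ha : a ∈ seriesH) (h : a ∈ level 2)
    (k : ℕ) (hk : k ≠ 0) : KillsTorsion (PowerSeries.coeff k a) := by
  have := killsTorsion_coeff_mul ha one_mem_seriesH
    (fun t _ => by rw [mem_level_iff.1 h 1 one_lt_two]) (one_mul 1) k hk
  rwa [one_mul] at this

theorem mem_level_mono {m n : ℕ} (h : m ≤ n) {a : EndSeries} (ha : a ∈ level n) : a ∈ level m :=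
  mem_level_iff.2 fun k hk => mem_level_iff.1 ha k (hk.trans_le h)

/-- A closed normal subgroup containing all torsion-killing leading coefficients from some level
on contains everything torsion-killing from that level on. -/
theorem mem_of_forall_leadingGroup {N : Set EndSeries} (hN : IsClosedSubgroup N)
    (hNH : N ⊆ seriesH) (m : ℕ) (hm : 1 ≤ m)
    (hlead : ∀ k φ, KillsTorsion φ → φ ∈ leadingGroup hN (m + k)) {a : EndSeries}
    (ha : a ∈ level (m + 1)) (hator : ∀ k ≠ 0, KillsTorsion (PowerSeries.coeff k a)) : a ∈ N := by
  -- `Z k` collects the members of `N` approximating `a` up to degree `m + k`. These closed sets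
  -- decrease, and a point common to all of them equals `a`.
  let Z : ℕ → Set EndSeries := fun k =>
    (N ∩ level (m + 1)) ∩ ⋂ (j : ℕ) (_ : j < m + 1 + k),
      {ν | PowerSeries.coeff j ν = PowerSeries.coeff j a}
  have hclosed : ∀ k, IsClosed (Z k) := fun k =>
    (hN.isClosed.inter (isClosed_level _)).inter
      (isClosed_biInter fun j _ => isClosed_eq (continuous_coeff j) continuous_const)
  have hmem : ∀ k ν, ν ∈ Z k ↔ (ν ∈ N ∧ ν ∈ level (m + 1)) ∧
      ∀ j < m + 1 + k, PowerSeries.coeff j ν = PowerSeries.coeff j a := by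
    intro k ν
    simp [Z]
  have hne : ∀ k, (Z k).Nonempty := by
    intro k
    induction k with
    | zero =>
      refine ⟨1, (hmem _ _).2 ⟨⟨hN.one_mem, 0, by simp⟩, fun j hj => ?_⟩⟩
      exact (mem_level_iff.1 ha j hj).symm
    | succ k ih =>
      obtain ⟨ν, hν⟩ := ih
      obtain ⟨⟨hνN, hνl⟩, hνa⟩ := (hmem _ _).1 hν
      have hk0 : m + 1 + k ≠ 0 := by lia
      -- The discrepancy in the next degree kills torsion, `ν` being in level `2` because `1 ≤ m`.
      -- It is thus the leading coefficient of some `μ` in `N`, and `ν * μ` corrects it without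
      -- disturbing lower degrees.
      have htor : KillsTorsion
          (PowerSeries.coeff (m + 1 + k) a - PowerSeries.coeff (m + 1 + k) ν) := by
        intro t n hn hnt
        rw [CircleEnd.sub_apply, hator _ hk0 t n hn hnt,
          killsTorsion_coeff_of_mem_level (hNH hνN) (mem_level_mono (by lia) hνl) _ hk0 t n hn hnt,
          sub_self]
      obtain ⟨μ, hμN, ⟨b, hb⟩, hμc⟩ := (mem_leadingGroup hN).1 (hlead k _ htor)
      have hkm : m + 1 + k = m + k + 1 := by lia
      have hb0 : PowerSeries.coeff 0 b =
          PowerSeries.coeff (m + 1 + k) a - PowerSeries.coeff (m + 1 + k) ν := by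
        rw [← hμc, hb, coeff_one_add]
      have hνμ : ν * μ = ν + PowerSeries.X ^ (m + 1 + k) * (ν * b) := by
        rw [hkm, hb, mul_add, mul_one, ← mul_assoc, (PowerSeries.commute_X_pow ν _).eq, mul_assoc]
      refine ⟨ν * μ, (hmem _ _).2 ⟨⟨hN.mul_mem hνN hμN,
        mul_mem_level hνl (mem_level_mono (by lia) ⟨b, hb⟩)⟩, fun j hj => ?_⟩⟩
      rw [hνμ, map_add]
      rcases (show j < m + 1 + k ∨ j = m + 1 + k by lia) with hj' | hj'
      · rw [PowerSeries.coeff_X_pow_mul', if_neg (not_le.2 hj'), add_zero, hνa j hj']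
      · subst hj'
        have h0 : PowerSeries.coeff (m + 1 + k) (PowerSeries.X ^ (m + 1 + k) * (ν * b)) =
            PowerSeries.coeff 0 b := by
          rw [PowerSeries.coeff_X_pow_mul', if_pos le_rfl, Nat.sub_self]
          have := mem_level_iff.1 hνl 0 (Nat.succ_pos m)
          rw [PowerSeries.coeff_zero_eq_constantCoeff_apply] at this ⊢
          simp [this]
        rw [h0, hb0, add_sub_cancel]
  obtain ⟨ν, hν⟩ := IsCompact.nonempty_iInter_of_sequence_nonempty_isCompact_isClosed Z
    (fun k ν hν => by
      rw [hmem] at hν ⊢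
      exact ⟨hν.1, fun j hj => hν.2 j (by lia)⟩) hne (hclosed 0).isCompact hclosed
  have hν' : ∀ k, ν ∈ Z k := fun k => Set.mem_iInter.1 hν k
  have : ν = a := PowerSeries.ext fun k => ((hmem _ _).1 (hν' k)).2 k (by lia)
  rw [← this]
  exact ((hmem _ _).1 (hν' 0)).1.1

theorem inv_mul_mem_level {m : ℕ} {a b c : EndSeries} (hcb : c * b = 1)
    (hab : ∀ k < m, PowerSeries.coeff k a = PowerSeries.coeff k b) : c * a ∈ level m := by
  obtain ⟨d, hd⟩ : PowerSeries.X ^ m ∣ a - b := by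
    rw [PowerSeries.X_pow_dvd_iff]
    intro k hk
    rw [map_sub, hab k hk, sub_self]
  refine ⟨c * d, ?_⟩
  rw [← mul_assoc, ← (PowerSeries.commute_X_pow c m).eq, mul_assoc, ← hd, mul_sub, hcb,
    add_sub_cancel]

theorem isNormalised_orbitClosure : IsNormalised orbitClosure := fun _ hν _ hκ _ hκ' _ _ =>
  mul_mem_orbitClosure (mul_mem_orbitClosure hκ hν) hκ'

/-- The powers of `1 + X` are dense in `𝓗`. -/
theorem orbitClosure_eq_seriesH : orbitClosure = seriesH := by
  refine orbitClosure_subset_seriesH.antisymm fun a ha => ?_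
  obtain ⟨κ, hκ, hκa⟩ := exists_mem_orbitClosure_coeff_one (PowerSeries.coeff 1 a)
  obtain ⟨ψ, -, hψ⟩ := exists_killsTorsion_ne_zero
  obtain ⟨κ', hκ', h1, h2⟩ := isClosedSubgroup_orbitClosure.inv_mem κ hκ
  -- Dividing `a` by an orbit-closure element with the same first coefficient leaves a series in
  -- level `2` that kills torsion in positive degrees, where the approximation applies.
  have hmem : κ' * a ∈ orbitClosure := by
    refine mem_of_forall_leadingGroup isClosedSubgroup_orbitClosure orbitClosure_subset_seriesH 1
      le_rfl (fun k φ hφ => ?_) (inv_mul_mem_level h2 fun k hk => ?_)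
      (killsTorsion_coeff_mul ha (orbitClosure_subset_seriesH hκ) (fun t _ => by rw [hκa]) h2)
    · have := mem_leadingGroup_of_lt isClosedSubgroup_orbitClosure isNormalised_orbitClosure 0
        ⟨ψ, leadingGroup_orbitClosure ψ, hψ⟩ k hφ
      rwa [zero_add] at this
    · interval_cases k
      · rw [coeff_zero_of_mem hκ, ((mem_seriesH_iff a).1 ha).1]
      · exact hκa.symm
  have := mul_mem_orbitClosure hκ hmem
  rwa [← mul_assoc, h1, one_mul] at this

/-- A nontrivial closed normal subgroup `N` of the closure of the powers of `1 + X` consists of all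
members of that closure of some level whose leading coefficient is one of `N`. -/
theorem eq_one_or_exists_level {N : Set EndSeries} (hN : IsClosedSubgroup N)
    (hnorm : IsNormalised N) (hNK : N ⊆ orbitClosure) : N = {1} ∨
      ∃ r, N ⊆ level (r + 1) ∧ ∀ a ∈ orbitClosure, a ∈ level (r + 1) →
        PowerSeries.coeff (r + 1) a ∈ leadingGroup hN r → a ∈ N := by
  classical
  have hstep : ∀ r, (∀ j < r, ∀ φ ∈ leadingGroup hN j, φ = 0) → N ⊆ level (r + 1) := by
    intro r
    induction r with
    | zero => exact fun _ a ha => level_one_of_mem (hNK ha)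
    | succ r ih =>
      intro h a ha
      have har := ih (fun j hj => h j (hj.trans (Nat.lt_succ_self r))) ha
      have hz := h r (Nat.lt_succ_self r) _ ((mem_leadingGroup hN).2 ⟨a, ha, har, rfl⟩)
      rw [mem_level_iff] at har ⊢
      intro k hk
      rcases Nat.lt_succ_iff_lt_or_eq.1 hk with hk | rfl
      · exact har k hk
      · rw [hz, PowerSeries.coeff_one, if_neg (Nat.succ_ne_zero r)]
  by_cases hex : ∃ m, ∃ φ ∈ leadingGroup hN m, φ ≠ 0
  · right
    -- Here `r` is the first index with a nonzero leading group.
    refine ⟨Nat.find hex, hstep _ fun j hj φ hφ => ?_, fun a ha har hac => ?_⟩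
    · by_contra h0
      exact Nat.find_min hex hj ⟨φ, hφ, h0⟩
    have hne := Nat.find_spec hex
    generalize Nat.find hex = r at *
    obtain ⟨ν, hν, hνr, hνa⟩ := (mem_leadingGroup hN).1 hac
    obtain ⟨ν', hν', h1, h2⟩ := hN.inv_mem ν hν
    have hco : ∀ k < r + 2, PowerSeries.coeff k a = PowerSeries.coeff k ν := by
      intro k hk
      rcases Nat.lt_succ_iff_lt_or_eq.1 hk with hk | rfl
      · rw [mem_level_iff.1 har k hk, mem_level_iff.1 hνr k hk]
      · exact hνa.symm
    -- Now `a` and `ν` agree through degree `r + 1`, so the quotient lies in level `r + 2`, above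
    -- which the leading groups contain everything that kills torsion.
    have hmem : ν' * a ∈ N := by
      refine mem_of_forall_leadingGroup hN (hNK.trans orbitClosure_subset_seriesH) (r + 1)
        (Nat.le_add_left 1 r) (fun k φ hφ => mem_leadingGroup_of_lt hN hnorm r hne k hφ)
        (inv_mul_mem_level h2 hco)
        (killsTorsion_coeff_mul (orbitClosure_subset_seriesH ha)
          (orbitClosure_subset_seriesH (hNK hν)) (fun t _ => by rw [hco 1 (by lia)]) h2)
    have := hN.mul_mem hν hmem
    rwa [← mul_assoc, h1, one_mul] at this
  · left
    push Not at hex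
    refine Set.Subset.antisymm (fun a ha => ?_) (Set.singleton_subset_iff.2 hN.one_mem)
    refine PowerSeries.ext fun k => ?_
    exact mem_level_iff.1 (hstep k (fun j _ φ hφ => hex j φ hφ) ha) k (Nat.lt_succ_self k)

end EndSeries

/-! ### Functions of polynomial type -/

/-- The circle-valued functions `n ↦ exp (2 π i p(n))`, `p` a real polynomial. -/
def IsPolyType (f : ℤ → Circle) : Prop :=
  ∃ p : ℝ[X], ∀ n : ℤ, f n = Circle.exp (2 * Real.pi * p.eval (n : ℝ))

theorem exists_antidifference (p : ℝ[X]) :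
    ∃ q : ℝ[X], ∀ x : ℝ, q.eval (x + 1) = p.eval x + q.eval x := by
  induction p using Polynomial.induction_on' with
  | add p p' hp hp' =>
    obtain ⟨q, hq⟩ := hp
    obtain ⟨q', hq'⟩ := hp'
    refine ⟨q + q', fun x => ?_⟩
    rw [eval_add, eval_add, eval_add, hq, hq']
    ring
  | monomial n c =>
    -- The Bernoulli identity `B_{n+1}(x + 1) - B_{n+1}(x) = (n + 1) x ^ n` gives the antidifference
    -- of a monomial.
    refine ⟨C (c / (n + 1)) * (Polynomial.bernoulli (n + 1)).map (algebraMap ℚ ℝ), fun x => ?_⟩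
    have h := congrArg (fun r : ℚ[X] => (r.map (algebraMap ℚ ℝ)).eval x)
      (Polynomial.bernoulli_comp_one_add_X (n + 1))
    simp only [Polynomial.map_comp, eval_comp, Polynomial.map_add, Polynomial.map_one, map_X,
      eval_add, eval_one, eval_X] at h
    have hn : (n : ℝ) + 1 ≠ 0 := by positivity
    rw [eval_mul, eval_mul, eval_C, add_comm x 1, h]
    simp
    field_simp
    ring

theorem eq_of_recurrence {G : Type*} [Group G] {f g h : ℤ → G}
    (hf : ∀ n, f (n + 1) = g n * f n) (hh : ∀ n, h (n + 1) = g n * h n) (h0 : f 0 = h 0) (n : ℤ) :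
    f n = h n := by
  induction n using Int.induction_on with
  | zero => exact h0
  | succ n ih => rw [hf, hh, ih]
  | pred n ih =>
    have h1 := hf (-(n : ℤ) - 1)
    have h2 := hh (-(n : ℤ) - 1)
    rw [sub_add_cancel] at h1 h2
    rw [h1, h2] at ih
    exact mul_left_cancel ih

theorem IsPolyType.const (c : Circle) : IsPolyType fun _ => c := by
  refine ⟨C (Complex.arg (c : ℂ) / (2 * Real.pi)), fun n => ?_⟩
  have := Real.pi_pos
  rw [eval_C, mul_div_cancel₀ _ (by positivity), Circle.exp_arg]

theorem IsPolyType.mul {f g : ℤ → Circle} (hf : IsPolyType f) (hg : IsPolyType g) :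
    IsPolyType fun n => f n * g n := by
  obtain ⟨p, hp⟩ := hf
  obtain ⟨q, hq⟩ := hg
  refine ⟨p + q, fun n => ?_⟩
  change f n * g n = _
  rw [hp, hq, ← Circle.exp_add, eval_add, mul_add]

theorem IsPolyType.of_recurrence {f g : ℤ → Circle} (hg : IsPolyType g)
    (hf : ∀ n, f (n + 1) = g n * f n) : IsPolyType f := by
  obtain ⟨p, hp⟩ := hg
  obtain ⟨q, hq⟩ := exists_antidifference p
  have h1 : IsPolyType fun n : ℤ => Circle.exp (2 * Real.pi * q.eval (n : ℝ)) := ⟨q, fun n => rfl⟩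
  have h2 := (IsPolyType.const (f 0 * (Circle.exp (2 * Real.pi * q.eval 0))⁻¹)).mul h1
  convert h2 using 1
  funext n
  refine eq_of_recurrence (h := fun n : ℤ => f 0 * (Circle.exp (2 * Real.pi * q.eval 0))⁻¹ *
    Circle.exp (2 * Real.pi * q.eval (n : ℝ))) hf (fun n => ?_) (by simp) n
  push_cast
  rw [hq, mul_add, Circle.exp_add, ← hp]
  exact mul_left_comm _ _ _

/-! ### Quasi-eigenfunctions -/

section QuasiEigen

variable {X : Type u} [TopologicalSpace X]

theorem quasiEigenGroup_le_succ (s : X ≃ₜ X) (m : ℕ) :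
    quasiEigenGroup s m ≤ quasiEigenGroup s (m + 1) := by
  induction m with
  | zero =>
    rintro g ⟨c, hc⟩
    exact ⟨1, one_mem _, fun x => by simp [hc]⟩
  | succ m ih =>
    rintro g ⟨f, hf, hg⟩
    exact ⟨f, ih hf, hg⟩

theorem quasiEigenGroup_mono (s : X ≃ₜ X) : Monotone (quasiEigenGroup s) :=
  monotone_nat_of_le_succ (quasiEigenGroup_le_succ s)

/-- The group of all quasi-eigenfunctions. -/
def quasiEigenfunctions (s : X ≃ₜ X) : Subgroup C(X, Circle) where
  carrier := {g | IsQuasiEigenfunction s g}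
  one_mem' := ⟨0, one_mem _⟩
  mul_mem' := by
    rintro a b ⟨m, hm⟩ ⟨n, hn⟩
    exact ⟨max m n, mul_mem (quasiEigenGroup_mono s (le_max_left m n) hm)
      (quasiEigenGroup_mono s (le_max_right m n) hn)⟩
  inv_mem' := by
    rintro a ⟨m, hm⟩
    exact ⟨m, inv_mem hm⟩

theorem hasQuasiDiscreteSpectrum_of_separatesPoints [CompactSpace X] (s : X ≃ₜ X)
    (h : ∀ x y : X, x ≠ y → ∃ g : C(X, Circle), IsQuasiEigenfunction s g ∧ g x ≠ g y) :
    HasQuasiDiscreteSpectrum s :=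
  dense_span_of_separatesPoints (quasiEigenfunctions s) h

theorem zpow_succ_apply (s : X ≃ₜ X) (n : ℤ) (x : X) :
    (s ^ (n + 1) : X ≃ₜ X) x = s ((s ^ n : X ≃ₜ X) x) := by
  rw [add_comm, zpow_one_add]
  rfl

theorem semiconj_zpow {Y : Type v} [TopologicalSpace Y] {s : X ≃ₜ X} {t : Y ≃ₜ Y} {π : X → Y}
    (h : ∀ x, π (s x) = t (π x)) (n : ℤ) (x : X) :
    π ((s ^ n : X ≃ₜ X) x) = (t ^ n : Y ≃ₜ Y) (π x) := by
  induction n using Int.induction_on with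
  | zero => rfl
  | succ n ih => rw [zpow_succ_apply, zpow_succ_apply, h, ih]
  | pred n ih =>
    have h1 := zpow_succ_apply s (-(n : ℤ) - 1) x
    have h2 := zpow_succ_apply t (-(n : ℤ) - 1) (π x)
    rw [sub_add_cancel] at h1 h2
    apply t.injective
    rw [← h, ← h1, ih, h2]

theorem isPolyType_of_quasiEigenfunction {s : X ≃ₜ X} {g : C(X, Circle)}
    (hg : IsQuasiEigenfunction s g) (x : X) : IsPolyType fun n : ℤ => g ((s ^ n : X ≃ₜ X) x) := by
  obtain ⟨m, hm⟩ := hg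
  induction m generalizing g with
  | zero =>
    obtain ⟨c, hc⟩ := hm
    simp only [hc]
    exact IsPolyType.const c
  | succ m ih =>
    obtain ⟨f, hf, hg⟩ := hm
    refine (ih hf).of_recurrence fun n => ?_
    rw [zpow_succ_apply, hg]

variable [CompactSpace X]

theorem omega_apply (s : X ≃ₜ X) (x : X) (f : C(X, ℂ)) (n : ℤ) :
    omega s x f n = f ((s ^ n : X ≃ₜ X) x) := rfl

/-- The map `ω_x` as a continuous linear map. -/
def omegaCLM (s : X ≃ₜ X) (x : X) : C(X, ℂ) →L[ℂ] BoundedContinuousFunction ℤ ℂ :=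
  LinearMap.mkContinuous
    { toFun := omega s x
      map_add' := fun _ _ => rfl
      map_smul' := fun _ _ => rfl } 1 (fun f => by
        rw [one_mul]
        exact (BoundedContinuousFunction.norm_le (norm_nonneg f)).2 fun n => f.norm_coe_le_norm _)

theorem mem_polynomialType_of_isPolyType {f : ℤ → Circle} (hf : IsPolyType f)
    {w : BoundedContinuousFunction ℤ ℂ} (hw : ∀ n, w n = f n) : w ∈ polynomialType := by
  obtain ⟨p, hp⟩ := hf
  refine ⟨p, fun n => ?_⟩
  rw [hw, hp, Circle.coe_exp]
  congr 1
  push_cast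
  ring

theorem isClosed_weylAlgebra : IsClosed (weylAlgebra : Set (BoundedContinuousFunction ℤ ℂ)) :=
  Submodule.isClosed_topologicalClosure _

theorem omega_mem_weylAlgebra_of_hasQuasiDiscreteSpectrum {s : X ≃ₜ X}
    (h : HasQuasiDiscreteSpectrum s) (x : X) (f : C(X, ℂ)) : omega s x f ∈ weylAlgebra := by
  have hcl : IsClosed {f : C(X, ℂ) | omegaCLM s x f ∈ weylAlgebra} :=
    isClosed_weylAlgebra.preimage (omegaCLM s x).continuous
  have hsub : Submodule.span ℂ {f : C(X, ℂ) | ∃ g : C(X, Circle), IsQuasiEigenfunction s g ∧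
      ∀ x, f x = (g x : ℂ)} ≤ weylAlgebra.comap (omegaCLM s x).toLinearMap := by
    rw [Submodule.span_le]
    rintro f ⟨g, hg, hfg⟩
    refine Submodule.le_topologicalClosure _ (Submodule.subset_span ?_)
    exact mem_polynomialType_of_isPolyType (isPolyType_of_quasiEigenfunction hg x)
      fun n => hfg _
  exact hcl.closure_subset_iff.2 hsub (h f)

theorem omega_mem_weylAlgebra_of_semiconj {Y : Type v} [TopologicalSpace Y] [CompactSpace Y]
    {s : X ≃ₜ X} {t : Y ≃ₜ Y} {π : X → Y} (hπ : Continuous π) (h : ∀ x, π (s x) = t (π x)) (x : X)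
    (hx : ∀ f, omega s x f ∈ weylAlgebra) (f : C(Y, ℂ)) : omega t (π x) f ∈ weylAlgebra := by
  have : omega t (π x) f = omega s x (f.comp ⟨π, hπ⟩) := by
    ext n
    rw [omega_apply, omega_apply, ← semiconj_zpow h]
    rfl
  rw [this]
  exact hx _

end QuasiEigen

namespace EndSeries

/-! ### The system of the closure of the powers of `1 + X` -/

instance : CompactSpace orbitClosure := isCompact_iff_compactSpace.1 isClosed_orbitClosure.isCompact

/-- Multiplication by `1 + X` on the closure of the powers of `1 + X`. -/
def shiftOrbit : orbitClosure ≃ₜ orbitClosure where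
  toFun a := ⟨((shiftUnit : EndSeriesˣ) : EndSeries) * a, by
    have := zpow_mul_mem_orbitClosure 1 a.2
    rwa [zpow_one] at this⟩
  invFun a := ⟨((shiftUnit⁻¹ : EndSeriesˣ) : EndSeries) * a, by
    have := zpow_mul_mem_orbitClosure (-1) a.2
    rwa [zpow_neg_one] at this⟩
  left_inv a := Subtype.ext (Units.inv_mul_cancel_left _ _)
  right_inv a := Subtype.ext (Units.mul_inv_cancel_left _ _)
  continuous_toFun := by
    refine Continuous.subtype_mk ?_ _
    have h := (continuous_mul_right (shiftUnit : EndSeries)).comp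
      (continuous_subtype_val (p := (· ∈ orbitClosure)))
    convert h using 2 with a
    have := (commute_shiftUnit (a : EndSeries) 1).eq
    rw [zpow_one] at this
    exact this.symm
  continuous_invFun := by
    refine Continuous.subtype_mk ?_ _
    have h := (continuous_mul_right ((shiftUnit⁻¹ : EndSeriesˣ) : EndSeries)).comp
      (continuous_subtype_val (p := (· ∈ orbitClosure)))
    convert h using 2 with a
    have := (commute_shiftUnit (a : EndSeries) (-1)).eq
    rw [zpow_neg_one] at this
    exact this.symm

theorem coe_shiftOrbit (a : orbitClosure) :
    (shiftOrbit a : EndSeries) = (shiftUnit : EndSeries) * a := rfl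

theorem coe_shiftOrbit_zpow (n : ℤ) (a : orbitClosure) :
    ((shiftOrbit ^ n : orbitClosure ≃ₜ orbitClosure) a : EndSeries) =
      ((shiftUnit ^ n : EndSeriesˣ) : EndSeries) * a := by
  induction n using Int.induction_on with
  | zero => simp
  | succ n ih =>
    rw [zpow_succ_apply, coe_shiftOrbit, ih, ← mul_assoc, ← Units.val_mul, ← zpow_one_add,
      add_comm]
  | pred n ih =>
    have h1 := zpow_succ_apply shiftOrbit (-(n : ℤ) - 1) a
    rw [sub_add_cancel] at h1
    rw [h1, coe_shiftOrbit] at ih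
    apply (Units.isUnit shiftUnit).mul_left_cancel
    rw [ih, ← mul_assoc, ← Units.val_mul, ← zpow_one_add]
    congr 3
    ring

/-- The unit element of the closure of the powers of `1 + X`. -/
def orbitOne : orbitClosure := ⟨1, one_mem_orbitClosure⟩

theorem dense_orbit :
    Dense (Set.range fun n : ℤ => (shiftOrbit ^ n : orbitClosure ≃ₜ orbitClosure) orbitOne) := by
  intro a
  rw [closure_subtype, ← Set.range_comp]
  have h : (Subtype.val ∘ fun n : ℤ => (shiftOrbit ^ n : orbitClosure ≃ₜ orbitClosure) orbitOne) =
      fun n : ℤ => ((shiftUnit ^ n : EndSeriesˣ) : EndSeries) := by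
    funext n
    rw [Function.comp_apply, coe_shiftOrbit_zpow, orbitOne, mul_one]
  rw [h]
  exact a.2

/-- The coordinate function `a ↦ a_k(t)`. -/
def coord (k : ℕ) (t : Additive Circle) : C(orbitClosure, Circle) :=
  ⟨fun a => (PowerSeries.coeff k (a : EndSeries) t).toMul,
    (CircleEnd.continuous_eval t).comp ((continuous_coeff k).comp continuous_subtype_val)⟩

theorem coord_zero (t : Additive Circle) (a : orbitClosure) : coord 0 t a = t.toMul := by
  change (PowerSeries.coeff 0 (a : EndSeries) t).toMul = _
  rw [coeff_zero_of_mem a.2]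
  rfl

theorem coord_shiftOrbit (k : ℕ) (t : Additive Circle) (a : orbitClosure) :
    coord (k + 1) t (shiftOrbit a) = coord k t a * coord (k + 1) t a := by
  have h : PowerSeries.coeff (k + 1) (shiftOrbit a : EndSeries) =
      PowerSeries.coeff k (a : EndSeries) + PowerSeries.coeff (k + 1) (a : EndSeries) := by
    rw [coe_shiftOrbit, coe_shiftUnit, add_mul, one_mul, map_add, PowerSeries.coeff_succ_X_mul,
      add_comm]
  exact congrArg (fun φ : CircleEnd => (φ t).toMul) h

theorem coord_mem_quasiEigenGroup (k : ℕ) (t : Additive Circle) :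
    coord k t ∈ quasiEigenGroup shiftOrbit k := by
  induction k with
  | zero => exact ⟨t.toMul, coord_zero t⟩
  | succ k ih => exact ⟨coord k t, ih, coord_shiftOrbit k t⟩

theorem eq_of_coord_eq {a b : orbitClosure} (h : ∀ k t, coord k t a = coord k t b) : a = b :=
  Subtype.ext (PowerSeries.ext fun k => AddMonoidHom.ext fun t => h k t)

theorem hasQuasiDiscreteSpectrum_shiftOrbit : HasQuasiDiscreteSpectrum shiftOrbit := by
  refine hasQuasiDiscreteSpectrum_of_separatesPoints _ fun a b hab => ?_
  by_contra! h
  exact hab (eq_of_coord_eq fun k t => h _ ⟨k, coord_mem_quasiEigenGroup k t⟩)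

/-- The group generated by the coordinate functions. -/
def coordGroup : Subgroup C(orbitClosure, Circle) :=
  Subgroup.closure (Set.range fun p : ℕ × Additive Circle => coord p.1 p.2)

theorem coord_mem_coordGroup (k : ℕ) (t : Additive Circle) : coord k t ∈ coordGroup :=
  Subgroup.subset_closure ⟨(k, t), rfl⟩

theorem exists_coordGroup_antidifference {g : C(orbitClosure, Circle)} (hg : g ∈ coordGroup) :
    ∃ f ∈ coordGroup, ∀ a, f (shiftOrbit a) = g a * f a := by
  induction hg using Subgroup.closure_induction with
  | mem x hx =>
    obtain ⟨⟨k, t⟩, rfl⟩ := hx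
    exact ⟨_, coord_mem_coordGroup (k + 1) t, coord_shiftOrbit k t⟩
  | one => exact ⟨1, one_mem _, fun a => by simp⟩
  | mul x y _ _ hx hy =>
    obtain ⟨f, hf, hfx⟩ := hx
    obtain ⟨f', hf', hfy⟩ := hy
    refine ⟨f * f', mul_mem hf hf', fun a => ?_⟩
    simp only [ContinuousMap.mul_apply, hfx, hfy]
    exact mul_mul_mul_comm _ _ _ _
  | inv x _ hx =>
    obtain ⟨f, hf, hfx⟩ := hx
    exact ⟨f⁻¹, inv_mem hf, fun a => by simp only [ContinuousMap.inv_apply, hfx, mul_inv]⟩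

/-- The polynomials `p` for which `n ↦ exp (2 π i p(n))` is the restriction of a member of the
group generated by the coordinate functions. -/
def coordPolynomials : AddSubgroup ℝ[X] where
  carrier := {p | ∃ g ∈ coordGroup, ∀ n : ℤ, g ((shiftOrbit ^ n : orbitClosure ≃ₜ orbitClosure)
    orbitOne) = Circle.exp (2 * Real.pi * p.eval (n : ℝ))}
  zero_mem' := ⟨1, one_mem _, fun n => by simp⟩
  add_mem' := by
    rintro p q ⟨g, hg, hp⟩ ⟨f, hf, hq⟩
    exact ⟨g * f, mul_mem hg hf, fun n => by
      rw [ContinuousMap.mul_apply, hp, hq, ← Circle.exp_add, eval_add, mul_add]⟩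
  neg_mem' := by
    rintro p ⟨g, hg, hp⟩
    exact ⟨g⁻¹, inv_mem hg, fun n => by
      rw [ContinuousMap.inv_apply, hp, ← Circle.exp_neg, eval_neg, mul_neg]⟩

theorem mem_coordPolynomials_of_difference {p q : ℝ[X]} (hp : p ∈ coordPolynomials)
    (hq : ∀ x : ℝ, q.eval (x + 1) = p.eval x + q.eval x) : q ∈ coordPolynomials := by
  obtain ⟨g, hg, hgp⟩ := hp
  obtain ⟨f, hf, hfg⟩ := exists_coordGroup_antidifference hg
  set c : Circle := Circle.exp (2 * Real.pi * q.eval 0) * (f orbitOne)⁻¹ with hc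
  -- The coordinates of index `0` are the constants; `c` adjusts the value at `n = 0`, after which
  -- the recurrence determines the rest.
  refine ⟨coord 0 (Additive.ofMul c) * f, mul_mem (coord_mem_coordGroup _ _) hf, fun n => ?_⟩
  refine eq_of_recurrence (g := fun n : ℤ => Circle.exp (2 * Real.pi * p.eval (n : ℝ)))
    (f := fun n : ℤ => (coord 0 (Additive.ofMul c) * f)
      ((shiftOrbit ^ n : orbitClosure ≃ₜ orbitClosure) orbitOne))
    (h := fun n : ℤ => Circle.exp (2 * Real.pi * q.eval (n : ℝ)))
    (fun n => ?_) (fun n => ?_) ?_ n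
  · simp only [ContinuousMap.mul_apply, coord_zero, zpow_succ_apply, hfg, hgp]
    exact mul_left_comm _ _ _
  · push_cast
    rw [hq, mul_add, Circle.exp_add]
  · simp [ContinuousMap.mul_apply, coord_zero, hc]

theorem C_mul_X_pow_mem_coordPolynomials (n : ℕ) (c : ℝ) :
    C c * X ^ n ∈ coordPolynomials := by
  induction n using Nat.strong_induction_on generalizing c with
  | _ n ih =>
    -- The difference `c (x + 1) ^ n - c x ^ n` has only terms of degree below `n`.
    refine mem_coordPolynomials_of_difference
      (p := ∑ j ∈ Finset.range n, C (c * n.choose j) * X ^ j) (sum_mem fun j hj => ?_) fun x => ?_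
    · exact ih j (Finset.mem_range.1 hj) _
    · simp only [eval_mul, eval_C, eval_pow, eval_X, eval_finsetSum]
      rw [add_pow, Finset.sum_range_succ, mul_add, Finset.mul_sum]
      congr 1
      · refine Finset.sum_congr rfl fun j _ => ?_
        rw [one_pow]
        ring
      · simp

theorem mem_coordPolynomials (p : ℝ[X]) : p ∈ coordPolynomials := by
  rw [p.as_sum_range_C_mul_X_pow]
  exact sum_mem fun j _ => C_mul_X_pow_mem_coordPolynomials j _

/-- The orbit of `1` is dense, so the supremum over it is the full norm. The range is then closed,
and it suffices to extend functions of polynomial type. -/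
theorem antilipschitz_omegaCLM : AntilipschitzWith 1 (omegaCLM shiftOrbit orbitOne) := by
  refine AddMonoidHomClass.antilipschitz_of_bound _ fun F => ?_
  rw [NNReal.coe_one, one_mul]
  refine (ContinuousMap.norm_le _ (norm_nonneg _)).2 fun a => ?_
  have hcl : IsClosed {a : orbitClosure | ‖F a‖ ≤ ‖omegaCLM shiftOrbit orbitOne F‖} :=
    isClosed_le (by fun_prop) continuous_const
  refine hcl.closure_subset_iff.2 ?_ (dense_orbit a)
  rintro _ ⟨n, rfl⟩
  exact (omegaCLM shiftOrbit orbitOne F).norm_coe_le_norm n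

/-- Every member of the Weyl algebra extends continuously to the closure of the powers of
`1 + X`. -/
theorem exists_extension_of_mem_weylAlgebra {w : BoundedContinuousFunction ℤ ℂ}
    (hw : w ∈ weylAlgebra) : ∃ F : C(orbitClosure, ℂ), omega shiftOrbit orbitOne F = w := by
  have hcl : IsClosed (LinearMap.range (omegaCLM shiftOrbit orbitOne).toLinearMap :
      Set (BoundedContinuousFunction ℤ ℂ)) :=
    antilipschitz_omegaCLM.isClosed_range (omegaCLM shiftOrbit orbitOne).uniformContinuous
  have hle : weylAlgebra ≤ LinearMap.range (omegaCLM shiftOrbit orbitOne).toLinearMap := by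
    refine Submodule.topologicalClosure_minimal _ ?_ hcl
    rw [Submodule.span_le]
    rintro w ⟨p, hp⟩
    obtain ⟨g, -, hg⟩ := mem_coordPolynomials p
    refine ⟨⟨fun a => (g a : ℂ), by fun_prop⟩, ?_⟩
    ext n
    rw [hp]
    change (g ((shiftOrbit ^ n : orbitClosure ≃ₜ orbitClosure) orbitOne) : ℂ) = _
    rw [hg, Circle.coe_exp]
    congr 1
    push_cast
    ring
  exact hle hw

/-- If `ω_x C(X) ⊆ 𝓦`, then `n ↦ s ^ n x` extends to the closure of the powers of `1 + X`. -/
theorem exists_orbit_map {X : Type u} [TopologicalSpace X] [CompactSpace X] [T2Space X]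
    (s : X ≃ₜ X) (x : X) (hx : ∀ f, omega s x f ∈ weylAlgebra) :
    ∃ π : orbitClosure → X, Continuous π ∧ (∀ a, π (shiftOrbit a) = s (π a)) ∧
      π orbitOne = x := by
  choose F hF using fun f => exists_extension_of_mem_weylAlgebra (hx f)
  -- Embed `X` as a closed subset of a product of copies of `ℂ`. The extensions `F f` assemble to a
  -- map into the product that agrees with the orbit of `x` on a dense set, so it takes values in
  -- `X`.
  let ι : X → (C(X, ℂ) → ℂ) := fun y f => f y
  have hιc : Continuous ι := continuous_pi fun f => f.continuous
  have hιi : Function.Injective ι := by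
    intro y z hyz
    by_contra hne
    obtain ⟨f, hf0, hf1, -⟩ := exists_continuous_zero_one_of_isClosed
      (isClosed_singleton (x := y)) (isClosed_singleton (x := z))
      (Set.disjoint_singleton.2 hne)
    have h := congrFun hyz ⟨fun a => (f a : ℂ), by fun_prop⟩
    have h' : (f y : ℂ) = f z := h
    rw [hf0 rfl, hf1 rfl] at h'
    simp at h'
  have hι : IsClosedEmbedding ι := hιc.isClosedEmbedding hιi
  let Φ : orbitClosure → (C(X, ℂ) → ℂ) := fun a f => F f a
  have hΦ : Continuous Φ := continuous_pi fun f => (F f).continuous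
  have hΦn : ∀ n : ℤ, Φ ((shiftOrbit ^ n : orbitClosure ≃ₜ orbitClosure) orbitOne) =
      ι ((s ^ n : X ≃ₜ X) x) := fun n => funext fun f => DFunLike.congr_fun (hF f) n
  have hrange : ∀ a, ∃ y, ι y = Φ a := by
    intro a
    refine (hι.isClosed_range.preimage hΦ).closure_subset_iff.2 ?_ (dense_orbit a)
    rintro _ ⟨n, rfl⟩
    exact ⟨_, (hΦn n).symm⟩
  choose π hπ using hrange
  have hπc : Continuous π := by
    rw [hι.isEmbedding.continuous_iff]
    exact hΦ.congr fun a => (hπ a).symm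
  have hπn : ∀ n : ℤ, π ((shiftOrbit ^ n : orbitClosure ≃ₜ orbitClosure) orbitOne) =
      (s ^ n : X ≃ₜ X) x := fun n => hιi ((hπ _).trans (hΦn n))
  refine ⟨π, hπc, fun a => ?_, hπn 0⟩
  have hcl : IsClosed {a | π (shiftOrbit a) = s (π a)} :=
    isClosed_eq (hπc.comp shiftOrbit.continuous) (s.continuous.comp hπc)
  refine hcl.closure_subset_iff.2 ?_ (dense_orbit a)
  rintro _ ⟨n, rfl⟩
  change π (shiftOrbit _) = s (π _)
  rw [← zpow_succ_apply, hπn, hπn, zpow_succ_apply]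

end EndSeries

/-! ### The enveloping semigroup -/

section Enveloping

variable {X : Type u} [TopologicalSpace X]

theorem isClosed_envelopingSemigroup (s : X ≃ₜ X) : IsClosed (envelopingSemigroup s) :=
  isClosed_closure

instance [CompactSpace X] (s : X ≃ₜ X) : CompactSpace (envelopingSemigroup s) :=
  isCompact_iff_compactSpace.1 (isClosed_envelopingSemigroup s).isCompact

theorem zpow_mem_envelopingSemigroup (s : X ≃ₜ X) (n : ℤ) :
    ((s ^ n : X ≃ₜ X) : X → X) ∈ envelopingSemigroup s := subset_closure ⟨n, rfl⟩

theorem id_mem_envelopingSemigroup (s : X ≃ₜ X) : id ∈ envelopingSemigroup s :=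
  zpow_mem_envelopingSemigroup s 0

theorem continuous_comp_right (b : X → X) : Continuous fun a : X → X => a ∘ b :=
  continuous_pi fun x => continuous_apply (b x)

theorem comp_mem_envelopingSemigroup {s : X ≃ₜ X} {a b : X → X} (ha : a ∈ envelopingSemigroup s)
    (hb : b ∈ envelopingSemigroup s) : a ∘ b ∈ envelopingSemigroup s := by
  have h1 : ∀ n : ℤ, ((s ^ n : X ≃ₜ X) : X → X) ∘ b ∈ envelopingSemigroup s := by
    intro n
    have hc : Continuous fun c : X → X => ((s ^ n : X ≃ₜ X) : X → X) ∘ c :=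
      continuous_pi fun x => (s ^ n : X ≃ₜ X).continuous.comp (continuous_apply x)
    refine map_mem_closure hc hb ?_
    rintro _ ⟨m, rfl⟩
    refine ⟨n + m, ?_⟩
    funext x
    simp only [zpow_add]
    rfl
  have := map_mem_closure (continuous_comp_right b) ha (t := envelopingSemigroup s) (by
    rintro _ ⟨n, rfl⟩
    exact h1 n)
  rwa [(isClosed_envelopingSemigroup s).closure_eq] at this

theorem apply_mem_of_isInvariant {s : X ≃ₜ X} {Z : Set X} (hZ : IsClosed Z)
    (hinv : IsInvariant s Z) {z : X} (hz : z ∈ Z) {b : X → X} (hb : b ∈ envelopingSemigroup s) :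
    b z ∈ Z := by
  refine (hZ.preimage (continuous_apply z)).closure_subset_iff.2 ?_ hb
  rintro _ ⟨n, rfl⟩
  change (s ^ n : X ≃ₜ X) z ∈ Z
  induction n using Int.induction_on with
  | zero => exact hz
  | succ n ih =>
    rw [zpow_succ_apply]
    exact (hinv.mem_iff _).1 ih
  | pred n ih =>
    have h1 := zpow_succ_apply s (-(n : ℤ) - 1) z
    rw [sub_add_cancel] at h1
    rw [h1] at ih
    exact (hinv.mem_iff _).2 ih

theorem IsDistal.exists_left_inverse [CompactSpace X] [T2Space X] {s : X ≃ₜ X} (h : IsDistal s)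
    {a : X → X} (ha : a ∈ envelopingSemigroup s) : ∃ b ∈ envelopingSemigroup s, b ∘ a = id := by
  let _ : Semigroup (X → X) := { mul := fun a b => a ∘ b, mul_assoc := fun _ _ _ => rfl }
  obtain ⟨p, ⟨b, hb, rfl⟩, hp⟩ := exists_idempotent_in_compact_subsemigroup
    (fun r : X → X => continuous_comp_right r) ((fun b => b ∘ a) '' envelopingSemigroup s)
    ⟨_, id, id_mem_envelopingSemigroup s, rfl⟩
    ((isClosed_envelopingSemigroup s).isCompact.image (continuous_comp_right a)) (by
      rintro _ ⟨x, hx, rfl⟩ _ ⟨y, hy, rfl⟩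
      exact ⟨(x ∘ a) ∘ y,
        comp_mem_envelopingSemigroup (comp_mem_envelopingSemigroup hx ha) hy, rfl⟩)
  refine ⟨b, hb, funext fun x => ?_⟩
  -- An injective idempotent `p` is the identity: cancel one `p` in `p (p x) = p x`.
  exact h _ (comp_mem_envelopingSemigroup hb ha) (congrFun hp x)

theorem isClosed_orbit [CompactSpace X] [T2Space X] (s : X ≃ₜ X) (x : X) :
    IsClosed ((fun a : X → X => a x) '' envelopingSemigroup s) :=
  ((isClosed_envelopingSemigroup s).isCompact.image (continuous_apply x)).isClosed

theorem isInvariant_orbit (s : X ≃ₜ X) (x : X) :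
    IsInvariant s ((fun a : X → X => a x) '' envelopingSemigroup s) := by
  have h : (leftMul s) '' envelopingSemigroup s = _ := envelopingSemigroup_invariant s
  unfold IsInvariant
  conv_rhs => rw [← h]
  rw [Set.image_image, Set.image_image]
  rfl

theorem restrict_semiconj (s : X ≃ₜ X) {Y : Set X} (hY : IsInvariant s Y) (y : Y) :
    ((restrict s hY y : Y) : X) = s y := rfl

/-- In a distal system all orbit closures are minimal. -/
theorem IsDistal.isMinimalSystem_orbit [CompactSpace X] [T2Space X] {s : X ≃ₜ X} (h : IsDistal s)
    (x : X) : IsMinimalSystem (restrict s (isInvariant_orbit s x)) := by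
  refine ⟨⟨⟨x, id, id_mem_envelopingSemigroup s, rfl⟩⟩, fun Z hZ hinv hne => ?_⟩
  obtain ⟨⟨_, a, ha, rfl⟩, hz⟩ := hne
  obtain ⟨b, hb, hba⟩ := h.exists_left_inverse ha
  have hZ' : IsClosed (Subtype.val '' Z) := (isClosed_orbit s x).isClosedMap_subtype_val _ hZ
  have hinv' : IsInvariant s (Subtype.val '' Z) := by
    have h1 : restrict s (isInvariant_orbit s x) '' Z = Z := hinv
    unfold IsInvariant
    conv_rhs => rw [← h1]
    rw [Set.image_image, Set.image_image]
    rfl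
  refine Set.eq_univ_of_forall ?_
  rintro ⟨_, c, hc, rfl⟩
  -- From `a x` in `Z` every `c x` is reached by `c ∘ b`, where `b ∘ a = id`.
  obtain ⟨y, hy, hyc⟩ := apply_mem_of_isInvariant hZ' hinv' ⟨_, hz, rfl⟩
    (comp_mem_envelopingSemigroup hc hb)
  have h2 : (y : X) = c x := hyc.trans (congrArg c (congrFun hba x))
  have h3 : y = ⟨c x, c, hc, rfl⟩ := Subtype.ext h2
  rwa [← h3]

theorem omega_mem_weylAlgebra_of_isWSystem [CompactSpace X] {s : X ≃ₜ X} (h : IsWSystem s)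
    (x : X) (f : C(X, ℂ)) : omega s x f ∈ weylAlgebra :=
  omega_mem_weylAlgebra_of_semiconj (s := ellisSystem s) (t := s)
    (π := fun a : envelopingSemigroup s => (a : X → X) x)
    ((continuous_apply x).comp continuous_subtype_val) (fun _ => rfl)
    ⟨id, id_mem_envelopingSemigroup s⟩
    (fun g => omega_mem_weylAlgebra_of_hasQuasiDiscreteSpectrum h _ g) f

end Enveloping

/-! ### Enveloping semigroups as quotients of the closure of the powers of `1 + X` -/

namespace EndSeries

theorem coeff_mul_of_le {r : ℕ} {c : EndSeries} (hc : c ∈ level (r + 1)) (a : EndSeries) {k : ℕ}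
    (hk : k ≤ r) : PowerSeries.coeff k (a * c) = PowerSeries.coeff k a := by
  obtain ⟨b, rfl⟩ := hc
  rw [mul_add, mul_one, ← mul_assoc, (PowerSeries.commute_X_pow a _).eq, mul_assoc, map_add,
    PowerSeries.coeff_X_pow_mul', if_neg (by lia), add_zero]

theorem coeff_succ_mul_of_mem_level {r : ℕ} {c : EndSeries} (hc : c ∈ level (r + 1))
    {a : EndSeries} (ha : PowerSeries.coeff 0 a = 1) : PowerSeries.coeff (r + 1) (a * c) =
      PowerSeries.coeff (r + 1) a + PowerSeries.coeff (r + 1) c := by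
  obtain ⟨b, rfl⟩ := hc
  rw [coeff_one_add, mul_add, mul_one, ← mul_assoc, (PowerSeries.commute_X_pow a _).eq, mul_assoc,
    map_add, PowerSeries.coeff_X_pow_mul', if_pos le_rfl, Nat.sub_self]
  rw [PowerSeries.coeff_zero_eq_constantCoeff_apply] at ha ⊢
  simp [ha]

instance : Mul orbitClosure := ⟨fun a b => ⟨a * b, mul_mem_orbitClosure a.2 b.2⟩⟩

theorem coe_mul (a b : orbitClosure) : ((a * b : orbitClosure) : EndSeries) = a * b := rfl

theorem exists_inverse (a : orbitClosure) :
    ∃ b : orbitClosure, a * b = orbitOne ∧ b * a = orbitOne := by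
  obtain ⟨b, hb, h1, h2⟩ := isClosedSubgroup_orbitClosure.inv_mem a a.2
  exact ⟨⟨b, hb⟩, Subtype.ext h1, Subtype.ext h2⟩

theorem orbitOne_mul (a : orbitClosure) : orbitOne * a = a := Subtype.ext (one_mul _)

theorem mul_orbitOne (a : orbitClosure) : a * orbitOne = a := Subtype.ext (mul_one _)

theorem orbit_mul_assoc (a b c : orbitClosure) : a * b * c = a * (b * c) :=
  Subtype.ext (mul_assoc _ _ _)

/-- The kernel of a homomorphism onto an enveloping semigroup. -/
def ellisKernel {X : Type u} (π : orbitClosure → X → X) : Set EndSeries := Subtype.val '' {a | π a = id}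

theorem mem_ellisKernel {X : Type u} {π : orbitClosure → X → X} (a : orbitClosure) : (a : EndSeries) ∈ ellisKernel π ↔ π a = id :=
  Subtype.val_injective.mem_set_image

theorem ellisKernel_subset {X : Type u} {π : orbitClosure → X → X} : ellisKernel π ⊆ orbitClosure := by
  rintro _ ⟨a, -, rfl⟩
  exact a.2

section EllisMap

variable {X : Type u} [TopologicalSpace X]

/-- Continuous homomorphisms from the closure of the powers of `1 + X` onto an enveloping
semigroup. -/
structure IsEllisMap (s : X ≃ₜ X) (π : orbitClosure → X → X) : Prop where
  continuous : Continuous π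
  range_eq : Set.range π = envelopingSemigroup s
  map_shift : ∀ a, π (shiftOrbit a) = s ∘ π a
  map_one : π orbitOne = id
  map_mul : ∀ a b, π (a * b) = π a ∘ π b

theorem exists_isEllisMap [CompactSpace X] [T2Space X] (s : X ≃ₜ X)
    (h : ∀ x f, omega s x f ∈ weylAlgebra) : ∃ π, IsEllisMap s π := by
  choose π hπc hπs hπ1 using fun x => exists_orbit_map s x (h x)
  have hn : ∀ (n : ℤ) (a : orbitClosure) (x : X),
      π x ((shiftOrbit ^ n : orbitClosure ≃ₜ orbitClosure) a) = (s ^ n : X ≃ₜ X) (π x a) :=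
    fun n a x => semiconj_zpow (hπs x) n a
  have hc : Continuous fun (a : orbitClosure) (x : X) => π x a := continuous_pi hπc
  refine ⟨fun a x => π x a, hc, ?_, fun a => funext fun x => hπs x a, funext hπ1, fun a b => ?_⟩
  · refine Set.Subset.antisymm ?_ ?_
    · rintro _ ⟨a, rfl⟩
      refine ((isClosed_envelopingSemigroup s).preimage hc).closure_subset_iff.2 ?_ (dense_orbit a)
      rintro _ ⟨n, rfl⟩
      refine subset_closure ⟨n, funext fun x => ?_⟩
      change _ = π x _
      rw [hn, hπ1]
    · refine (isCompact_range hc).isClosed.closure_subset_iff.2 ?_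
      rintro _ ⟨n, rfl⟩
      refine ⟨(shiftOrbit ^ n : orbitClosure ≃ₜ orbitClosure) orbitOne, funext fun x => ?_⟩
      change π x _ = _
      rw [hn, hπ1]
  -- Multiplicativity holds when `a` is a power of `1 + X` and passes to the limit in the left
  -- factor.
  · have hmul : Continuous fun a : orbitClosure => a * b :=
      ((continuous_mul_right (b : EndSeries)).comp continuous_subtype_val).subtype_mk _
    have hcl : IsClosed {a : orbitClosure | (fun x => π x (a * b)) = (fun x => π x a) ∘
        fun x => π x b} :=
      isClosed_eq (hc.comp hmul) ((continuous_comp_right _).comp hc)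
    refine hcl.closure_subset_iff.2 ?_ (dense_orbit a)
    rintro _ ⟨n, rfl⟩
    funext x
    have h1 : (shiftOrbit ^ n : orbitClosure ≃ₜ orbitClosure) orbitOne * b =
        (shiftOrbit ^ n : orbitClosure ≃ₜ orbitClosure) b := by
      refine Subtype.ext ?_
      rw [coe_mul, coe_shiftOrbit_zpow, coe_shiftOrbit_zpow, orbitOne, mul_one]
    rw [h1, hn, Function.comp_apply, hn, hπ1]

variable {s : X ≃ₜ X} {π : orbitClosure → X → X}

theorem IsEllisMap.isDistal (h : IsEllisMap s π) : IsDistal s := by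
  intro a ha
  rw [← h.range_eq] at ha
  obtain ⟨a, rfl⟩ := ha
  obtain ⟨b, -, hb⟩ := exists_inverse a
  have h1 : π b ∘ π a = id := by rw [← h.map_mul, hb, h.map_one]
  exact (Function.leftInverse_iff_comp.2 h1).injective

theorem IsEllisMap.isClosedSubgroup_kernel [T2Space X] (h : IsEllisMap s π) :
    IsClosedSubgroup (ellisKernel π) where
  isClosed := isClosed_orbitClosure.isClosedMap_subtype_val _
    (isClosed_eq h.continuous continuous_const)
  one_mem := ⟨orbitOne, h.map_one, rfl⟩
  mul_mem := by
    rintro _ _ ⟨a, ha, rfl⟩ ⟨b, hb, rfl⟩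
    refine ⟨a * b, ?_, rfl⟩
    change π (a * b) = id
    rw [h.map_mul, show π a = id from ha, show π b = id from hb]
    rfl
  inv_mem := by
    rintro _ ⟨a, ha, rfl⟩
    obtain ⟨b, h1, h2⟩ := exists_inverse a
    refine ⟨b, ⟨b, ?_, rfl⟩, congrArg Subtype.val h1, congrArg Subtype.val h2⟩
    have h3 := h.map_mul a b
    rw [h1, h.map_one, show π a = id from ha] at h3
    exact h3.symm

theorem IsEllisMap.isNormalised_kernel (h : IsEllisMap s π) : IsNormalised (ellisKernel π) := by
  rintro _ ⟨a, ha, rfl⟩ κ hκ κ' hκ' h1 -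
  have h2 : (⟨κ, hκ⟩ * ⟨κ', hκ'⟩ : orbitClosure) = orbitOne :=
    Subtype.ext ((coe_mul _ _).trans h1)
  have h3 : π (⟨κ, hκ⟩ * a * ⟨κ', hκ'⟩) = id := by
    rw [h.map_mul, h.map_mul, show π a = id from ha, Function.comp_id, ← h.map_mul, h2, h.map_one]
  have h4 := (mem_ellisKernel _).2 h3
  rwa [coe_mul, coe_mul] at h4

theorem IsEllisMap.exists_kernel_of_eq (h : IsEllisMap s π) {a b : orbitClosure}
    (hab : π a = π b) : ∃ c : orbitClosure, π c = id ∧ b = a * c := by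
  obtain ⟨a', h1, h2⟩ := exists_inverse a
  refine ⟨a' * b, ?_, ?_⟩
  · rw [h.map_mul, ← hab, ← h.map_mul, h2, h.map_one]
  · rw [← orbit_mul_assoc, h1, orbitOne_mul]

/-- A homomorphism onto an enveloping semigroup as a map into the subtype. -/
def ellisQuotient (h : IsEllisMap s π) (a : orbitClosure) : envelopingSemigroup s :=
  ⟨π a, h.range_eq ▸ ⟨a, rfl⟩⟩

theorem ellisQuotient_surjective (h : IsEllisMap s π) : Function.Surjective (ellisQuotient h) := by
  rintro ⟨b, hb⟩
  obtain ⟨a, rfl⟩ : b ∈ Set.range π := h.range_eq ▸ hb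
  exact ⟨a, rfl⟩

theorem isQuotientMap_ellisQuotient [T2Space X] (h : IsEllisMap s π) :
    IsQuotientMap (ellisQuotient h) := by
  have hc : Continuous (ellisQuotient h) := h.continuous.subtype_mk _
  exact hc.isClosedMap.isQuotientMap hc (ellisQuotient_surjective h)

theorem ellisSystem_ellisQuotient (h : IsEllisMap s π) (a : orbitClosure) :
    ellisSystem s (ellisQuotient h a) = ellisQuotient h (shiftOrbit a) :=
  Subtype.ext (h.map_shift a).symm

theorem exists_lift_coord [T2Space X] (h : IsEllisMap s π) (t : Additive Circle) (k : ℕ)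
    (hk : ∀ a b, π a = π b → coord k t a = coord k t b) :
    ∃ g : C(envelopingSemigroup s, Circle), ∀ a, g (ellisQuotient h a) = coord k t a := by
  let q : C(orbitClosure, envelopingSemigroup s) := ⟨ellisQuotient h, h.continuous.subtype_mk _⟩
  have hf : Function.FactorsThrough (coord k t) q :=
    fun a b hab => hk a b (congrArg Subtype.val hab)
  have hq : IsQuotientMap q := isQuotientMap_ellisQuotient h
  exact ⟨hq.lift _ hf, fun a => DFunLike.congr_fun (hq.lift_comp _ hf) a⟩

/-- Descent is required for all `j ≤ k` because the shift multiplies each coordinate by the previous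
one, which must itself be a quasi-eigenfunction on the quotient. -/
theorem exists_quasiEigen_of_coord [T2Space X] (h : IsEllisMap s π) (t : Additive Circle) (k : ℕ)
    (hk : ∀ j ≤ k, ∀ a b, π a = π b → coord j t a = coord j t b) :
    ∃ g ∈ quasiEigenGroup (ellisSystem s) k, ∀ a, g (ellisQuotient h a) = coord k t a := by
  induction k with
  | zero =>
    obtain ⟨g, hg⟩ := exists_lift_coord h t 0 (hk 0 le_rfl)
    refine ⟨g, ⟨t.toMul, fun x => ?_⟩, hg⟩
    obtain ⟨a, rfl⟩ := ellisQuotient_surjective h x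
    rw [hg, coord_zero]
  | succ k ih =>
    obtain ⟨g, hg⟩ := exists_lift_coord h t (k + 1) (hk (k + 1) le_rfl)
    obtain ⟨f, hf, hfa⟩ := ih fun j hj => hk j (hj.trans k.le_succ)
    refine ⟨g, ⟨f, hf, fun x => ?_⟩, hg⟩
    obtain ⟨a, rfl⟩ := ellisQuotient_surjective h x
    rw [ellisSystem_ellisQuotient, hg, hg, hfa, coord_shiftOrbit]

theorem IsEllisMap.isWSystem [CompactSpace X] [T2Space X] (h : IsEllisMap s π) : IsWSystem s := by
  refine hasQuasiDiscreteSpectrum_of_separatesPoints _ fun x y hxy => ?_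
  obtain ⟨a, rfl⟩ := ellisQuotient_surjective h x
  obtain ⟨b, rfl⟩ := ellisQuotient_surjective h y
  by_contra! hcon
  have hcoord : ∀ k t, (∀ j ≤ k, ∀ a b, π a = π b → coord j t a = coord j t b) →
      coord k t a = coord k t b := by
    intro k t hk
    obtain ⟨g, hg, hga⟩ := exists_quasiEigen_of_coord h t k hk
    rw [← hga, ← hga]
    exact hcon g ⟨k, hg⟩
  have hN := h.isClosedSubgroup_kernel
  rcases eq_one_or_exists_level hN h.isNormalised_kernel ellisKernel_subset with h1 | ⟨r, hr, hmem⟩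
  · have hinj : ∀ a b, π a = π b → a = b := by
      intro a b hab
      obtain ⟨c, hc, rfl⟩ := h.exists_kernel_of_eq hab
      have h2 : (c : EndSeries) ∈ ellisKernel π := (mem_ellisKernel c).2 hc
      rw [h1] at h2
      have h3 : c = orbitOne := Subtype.ext h2
      rw [h3, mul_orbitOne]
    refine hxy (congrArg _ (eq_of_coord_eq fun k t => hcoord k t fun j _ a b hab => ?_))
    rw [hinj a b hab]
  · have hlow : ∀ k ≤ r, ∀ t a b, π a = π b → coord k t a = coord k t b := by
      intro k hk t a b hab
      obtain ⟨c, hc, rfl⟩ := h.exists_kernel_of_eq hab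
      have h2 := coeff_mul_of_le (hr ((mem_ellisKernel c).2 hc)) (a : EndSeries) hk
      exact congrArg (fun φ : CircleEnd => (φ t).toMul) h2.symm
    -- In degree `r + 1`, multiplying by a kernel element adds its leading coefficient, so the
    -- coordinates at points `t` annihilated by the leading group descend.
    have hlead : ∀ t, (∀ φ ∈ leadingGroup hN r, φ t = 0) → ∀ a b, π a = π b →
        coord (r + 1) t a = coord (r + 1) t b := by
      intro t ht a b hab
      obtain ⟨c, hc, rfl⟩ := h.exists_kernel_of_eq hab
      have hcN := (mem_ellisKernel c).2 hc
      have h2 := coeff_succ_mul_of_mem_level (hr hcN) (coeff_zero_of_mem a.2)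
      have h3 := ht _ ((mem_leadingGroup hN).2 ⟨c, hcN, hr hcN, rfl⟩)
      have h4 : PowerSeries.coeff (r + 1) ((a * c : orbitClosure) : EndSeries) t =
          PowerSeries.coeff (r + 1) (a : EndSeries) t := by
        rw [coe_mul, h2, CircleEnd.add_apply, h3, add_zero]
      exact congrArg Additive.toMul h4.symm
    obtain ⟨a', h1, h2⟩ := exists_inverse a
    have hb : b = a * (a' * b) := by rw [← orbit_mul_assoc, h1, orbitOne_mul]
    have hlev : ((a' * b : orbitClosure) : EndSeries) ∈ level (r + 1) := by
      refine inv_mul_mem_level (congrArg Subtype.val h2) fun k hk => ?_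
      have hk' : k ≤ r := by lia
      exact AddMonoidHom.ext fun t =>
        (hcoord k t fun j hj a b hab => hlow j (hj.trans hk') t a b hab).symm
    have hco := coeff_succ_mul_of_mem_level hlev (coeff_zero_of_mem a.2)
    rw [← coe_mul, ← hb] at hco
    -- Agreement of the descended coordinates puts the leading coefficient of `a⁻¹ b` in the double
    -- annihilator of the leading group, which is that group itself; hence `a⁻¹ b` lies in the
    -- kernel.
    have hker : ((a' * b : orbitClosure) : EndSeries) ∈ ellisKernel π := by
      refine hmem _ (a' * b).2 hlev
        (mem_of_forall_annihilator _ (isClosed_leadingGroup hN r) _ fun t ht => ?_)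
      have h5 : coord (r + 1) t a = coord (r + 1) t b := by
        refine hcoord (r + 1) t fun j hj a b hab => ?_
        rcases Nat.le_succ_iff.1 hj with hj | rfl
        · exact hlow j hj t a b hab
        · exact hlead t ht a b hab
      have h6 : PowerSeries.coeff (r + 1) (a : EndSeries) t =
          PowerSeries.coeff (r + 1) (b : EndSeries) t := h5
      rw [hco, CircleEnd.add_apply] at h6
      exact left_eq_add.1 h6
    refine hxy (Subtype.ext ?_)
    change π a = π b
    rw [hb, h.map_mul, (mem_ellisKernel _).1 hker, Function.comp_id]

end EllisMap

/-! ### The system `𝓗` as a universal system -/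

theorem continuous_toSeq : Continuous toSeq := by
  refine continuous_pi fun k => continuous_induced_rng.2 (continuous_pi fun x => ?_)
  exact (CircleEnd.continuous_eval (Additive.ofMul x)).comp (continuous_coeff k)

theorem ofSeq_toSeq (a : EndSeries) : ofSeq (toSeq a) = a :=
  PowerSeries.ext fun k => by
    rw [ofSeq, PowerSeries.coeff_mk]
    rfl

theorem ofSeq_shiftFun (φ : ℕ → EndCircle) :
    ofSeq (shiftFun φ) = (shiftUnit : EndSeries) * ofSeq φ := by
  rw [← ofSeq_toSeq ((shiftUnit : EndSeries) * ofSeq φ), toSeq_shiftUnit_mul, toSeq_ofSeq]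

theorem toSeq_mem_spaceH (a : orbitClosure) : toSeq (a : EndSeries) ∈ spaceH :=
  orbitClosure_subset_seriesH a.2

theorem ofSeq_mem_orbitClosure (φ : spaceH) : ofSeq φ ∈ orbitClosure := by
  rw [orbitClosure_eq_seriesH]
  change toSeq (ofSeq φ) ∈ spaceH
  rw [toSeq_ofSeq]
  exact φ.2

end EndSeries

open EndSeries

theorem omega_mem_weylAlgebra_of_isFactor {X : Type u} [TopologicalSpace X] [CompactSpace X]
    {s : X ≃ₜ X} (h : IsFactor systemH s) (x : X) (f : C(X, ℂ)) : omega s x f ∈ weylAlgebra := by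
  obtain ⟨ρ, hρ, hsurj, heq⟩ := h
  obtain ⟨φ, rfl⟩ := hsurj x
  have h1 := omega_mem_weylAlgebra_of_semiconj (s := shiftOrbit) (t := s)
    (π := fun a : orbitClosure => ρ ⟨toSeq a, toSeq_mem_spaceH a⟩)
    (hρ.comp ((continuous_toSeq.comp continuous_subtype_val).subtype_mk _)) (fun a => by
      rw [← heq]
      exact congrArg ρ (Subtype.ext (toSeq_shiftUnit_mul a)))
    ⟨ofSeq φ, ofSeq_mem_orbitClosure φ⟩
    (fun g => omega_mem_weylAlgebra_of_hasQuasiDiscreteSpectrum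
      hasQuasiDiscreteSpectrum_shiftOrbit _ g) f
  have h2 : (⟨toSeq (ofSeq φ), toSeq_mem_spaceH ⟨ofSeq φ, ofSeq_mem_orbitClosure φ⟩⟩ : spaceH) =
      φ := Subtype.ext (toSeq_ofSeq φ)
  rw [← h2]
  exact h1

theorem isFactor_systemH {X : Type u} [TopologicalSpace X] [CompactSpace X] [T2Space X]
    {s : X ≃ₜ X} (hmin : IsMinimalSystem s) (x : X) (hx : ∀ f, omega s x f ∈ weylAlgebra) :
    IsFactor systemH s := by
  obtain ⟨π, hπ, heq, -⟩ := exists_orbit_map s x hx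
  -- The image is closed, nonempty and invariant, so minimality applies.
  have hsurj : Set.range π = Set.univ := by
    refine hmin.2 _ (isCompact_range hπ).isClosed ?_ ⟨_, orbitOne, rfl⟩
    refine Set.Subset.antisymm ?_ ?_
    · rintro _ ⟨_, ⟨a, rfl⟩, rfl⟩
      exact ⟨shiftOrbit a, heq a⟩
    · rintro _ ⟨a, rfl⟩
      refine ⟨_, ⟨shiftOrbit.symm a, rfl⟩, ?_⟩
      rw [← heq, Homeomorph.apply_symm_apply]
  refine ⟨fun φ => π ⟨ofSeq φ, ofSeq_mem_orbitClosure φ⟩,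
    hπ.comp ((continuous_ofSeq.comp continuous_subtype_val).subtype_mk _), fun y => ?_,
    fun φ => ?_⟩
  · obtain ⟨a, rfl⟩ : y ∈ Set.range π := hsurj ▸ Set.mem_univ y
    exact ⟨⟨toSeq a, toSeq_mem_spaceH a⟩, congrArg π (Subtype.ext (ofSeq_toSeq a))⟩
  · rw [← heq]
    exact congrArg π (Subtype.ext (ofSeq_shiftFun φ))

theorem isWSystem_of_omega_mem {X : Type u} [TopologicalSpace X] [CompactSpace X] [T2Space X]
    {s : X ≃ₜ X} (h : ∀ x f, omega s x f ∈ weylAlgebra) : IsWSystem s := by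
  obtain ⟨π, hπ⟩ := exists_isEllisMap s h
  exact hπ.isWSystem

theorem omega_restrict_mem_weylAlgebra {X : Type u} [TopologicalSpace X] [CompactSpace X]
    [T2Space X] {s : X ≃ₜ X} {Y : Set X} [CompactSpace Y] (hY : IsInvariant s Y) (hcl : IsClosed Y)
    (h : ∀ x f, omega s x f ∈ weylAlgebra) (y : Y) (f : C(Y, ℂ)) :
    omega (restrict s hY) y f ∈ weylAlgebra := by
  -- By Tietze's theorem, functions on the subsystem are restrictions of functions on `X`.
  obtain ⟨F, hF⟩ := ContinuousMap.exists_restrict_eq hcl f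
  have : omega (restrict s hY) y f = omega s y F := by
    ext n
    rw [omega_apply, omega_apply, ← hF,
      ← semiconj_zpow (s := restrict s hY) (t := s) (π := Subtype.val) (restrict_semiconj s hY)]
    rfl
  rw [this]
  exact h y F

end EllisW

end

/-! ### The two equivalences -/

theorem mainTheorem11 {X : Type*} [TopologicalSpace X] [CompactSpace X] [T2Space X]
    (s : X ≃ₜ X) :
    (EllisW.IsMinimalSystem s →
      List.TFAE [
        EllisW.IsWSystem s,
        EllisW.IsFactor EllisW.systemH s,
        ∃ x : X, Set.range (EllisW.omega s x) ⊆ EllisW.weylAlgebra,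
        ∀ x : X, Set.range (EllisW.omega s x) ⊆ EllisW.weylAlgebra]) ∧
    List.TFAE [
      EllisW.IsWSystem s,
      ∀ x : X, Set.range (EllisW.omega s x) ⊆ EllisW.weylAlgebra,
      EllisW.IsDistal s ∧
        ∀ (Y : Set X) (hY : EllisW.IsInvariant s Y), Y.Nonempty → IsClosed Y →
          EllisW.IsMinimalSystem (EllisW.restrict s hY) →
            EllisW.IsWSystem (EllisW.restrict s hY)] := by
  have h14 : EllisW.IsWSystem s → ∀ x : X, Set.range (EllisW.omega s x) ⊆ EllisW.weylAlgebra := by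
    rintro h x _ ⟨f, rfl⟩
    exact EllisW.omega_mem_weylAlgebra_of_isWSystem h x f
  have h41 : (∀ x : X, Set.range (EllisW.omega s x) ⊆ EllisW.weylAlgebra) → EllisW.IsWSystem s :=
    fun h => EllisW.isWSystem_of_omega_mem fun x f => h x ⟨f, rfl⟩
  refine ⟨fun hmin => ?_, ?_⟩
  · tfae_have 1 → 4 := h14
    tfae_have 4 → 1 := h41
    tfae_have 4 → 3 := fun h => hmin.1.elim fun x => ⟨x, h x⟩
    tfae_have 3 → 2 := fun ⟨x, hx⟩ => EllisW.isFactor_systemH hmin x fun f => hx ⟨f, rfl⟩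
    tfae_have 2 → 4 := by
      rintro h x _ ⟨f, rfl⟩
      exact EllisW.omega_mem_weylAlgebra_of_isFactor h x f
    tfae_finish
  · tfae_have 1 → 2 := h14
    tfae_have 2 → 1 := h41
    tfae_have 2 → 3 := by
      intro h
      have h' : ∀ x f, EllisW.omega s x f ∈ EllisW.weylAlgebra := fun x f => h x ⟨f, rfl⟩
      obtain ⟨π, hπ⟩ := EllisW.EndSeries.exists_isEllisMap s h'
      refine ⟨hπ.isDistal, fun Y hY _ hcl _ => ?_⟩
      have : CompactSpace Y := isCompact_iff_compactSpace.1 hcl.isCompact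
      exact EllisW.isWSystem_of_omega_mem (EllisW.omega_restrict_mem_weylAlgebra hY hcl h')
    tfae_have 3 → 2 := by
      rintro ⟨hd, h⟩ x _ ⟨f, rfl⟩
      have hcl := EllisW.isClosed_orbit s x
      -- Distality makes the orbit closure of `x` a minimal subsystem, and `ω_x` depends only on the
      -- restriction of functions to it.
      have hW := h _ (EllisW.isInvariant_orbit s x)
        ⟨x, id, EllisW.id_mem_envelopingSemigroup s, rfl⟩ hcl (hd.isMinimalSystem_orbit x)
      have : CompactSpace ((fun a : X → X => a x) '' EllisW.envelopingSemigroup s) :=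
        isCompact_iff_compactSpace.1 hcl.isCompact
      exact EllisW.omega_mem_weylAlgebra_of_semiconj (π := Subtype.val) continuous_subtype_val
        (EllisW.restrict_semiconj s (EllisW.isInvariant_orbit s x))
        ⟨x, id, EllisW.id_mem_envelopingSemigroup s, rfl⟩
        (EllisW.omega_mem_weylAlgebra_of_isWSystem hW _) f
    tfae_finish
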